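/- \textbf{Theorem (Combinatorial Reduction of Singularities).} For every polyhedra system $\mathcal D$ all of whose polyhedra are non-empty, there is a finite sequence of characteristic transforms $$\mathcal D=\mathcal D_0\rightarrow\mathcal D_1\rightarrow\cdots\rightarrow\mathcal D_k\qquad(k\ge 0)$$ such that $\mathrm{Sing}(\mathcal D_k)=\emptyset$. Here the following definitions are used. A \emph{support fabric} is a pair $\mathcal F=(I,\mathcal H)$ where $I$ is a finite set and $\mathcal H$ is a set of subsets of $I$ (the \emph{strata}) such that $J_1\subset J_2\in\mathcal H$ implies $J_1\in\mathcal H$. The \emph{blow-up} of $\mathcal F$ centered in a non-empty stratum $J$ is the support fabric $\pi_J(\mathcal F)=(I\cup\{\infty\},\mathcal H')$, $\infty\notin I$, where $$\mathcal H'=\{L\in\mathcal H:\ J\not\subset L\}\ \cup\ \{(K\setminus J)\cup A\cup\{\infty\}:\ K\in\mathcal H,\ J\subset K,\ A\subsetneq J\}.$$ For a finite set $J$ and $A\subset\mathbb R_{\ge 0}^J$, let $[[A]]$ be the convex hull of $A+\mathbb R^J_{\ge 0}$. A set $\Delta\subset\mathbb R^J_{\ge 0}$ is a \emph{characteristic polyhedron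 with denominator} $d\in\mathbb Z_{>0}$ if $\Delta=[[A]]$ for some $A\subset\frac1d\mathbb Z_{\ge 0}^J$. A \emph{polyhedra system} $\mathcal D=(\mathcal F;\{\Delta_J\}_{J\in\mathcal H},d)$ consists of a support fabric $\mathcal F=(I,\mathcal H)$, an integer $d\geq 1$ and, for each $J\in\mathcal H$, a characteristic polyhedron $\Delta_J\subset\mathbb R^J_{\ge 0}$ with denominator $d$, such that $\Delta_{J_1}$ is the image of $\Delta_{J_2}$ under the restriction map $\mathbb R^{J_2}\to\mathbb R^{J_1}$ whenever $J_1\subset J_2\in\mathcal H$. For non-empty $\Delta\subset\mathbb R_{\ge 0}^J$ as above, the \emph{contact exponent} is $\delta(\Delta)=\min\{\sum_{j\in J}\sigma(j):\ \sigma\in\Delta\}$ if $J\neq\emptyset$, and $\delta(\Delta)=-1$ if $J=\emptyset$. The \emph{singular locus} of $\mathcal D$ is $\mathrm{Sing}(\mathcal D)=\{J\in\mathcal H:\ \delta(\Delta_J)\ge 1\}$. For $J\in\mathrm{Sing}(\mathcal D)$, the \emph{characteristic transform} of $\mathcal D$ centered in $J$ is the polyhedra system $\Lambda_J(\mathcal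 D)=(\pi_J(\mathcal F);\{\Delta'_{J'}\}_{J'\in\mathcal H'},d)$ given as follows. If $\infty\notin J'$, then $\Delta'_{J'}=\Delta_{J'}$. If $\infty\in J'$, put $K=(J'\setminus\{\infty\})\cup J\in\mathcal H$ and let $\lambda_{J'}:\mathbb R^K\to\mathbb R^{J'}$ be defined by $\lambda_{J'}(\sigma)(j)=\sigma(j)$ for $j\neq\infty$ and $\lambda_{J'}(\sigma)(\infty)=\sum_{j\in J}\sigma(j)$; then $\Delta'_{J'}=[[\lambda_{J'}(\Delta_K)]]-e_{\infty}$, where $e_\infty\in\mathbb R^{J'}$ is the standard basis vector of the coordinate $\infty$. A \emph{sequence of characteristic transforms} is one in which each $\mathcal D_{i+1}$ is $\Lambda_{J}(\mathcal D_i)$ for some $J\in\mathrm{Sing}(\mathcal D_i)$. -/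

import Mathlib

open scoped Pointwise

universe u

namespace PolyhedraSystems

/-! ### Support fabrics -/

/-- A support fabric `(I, H)` with index set `I` (a finite type wherever it matters): a set `H` of
finite subsets of `I` (the strata) which is closed under passing to subsets, i.e. open for the
Zariski topology on the power set. -/
structure SupportFabric (I : Type u) where
  strata : Set (Finset I)
  mem_of_subset : ∀ ⦃J₁ J₂ : Finset I⦄, J₁ ⊆ J₂ → J₂ ∈ strata → J₁ ∈ strata

/-- The strata of the blow-up centered in `J`, as subsets of `I ∪ {∞} = Option I` (`none` is `∞`):
the strata of `H` that do not contain `J`, together with the sets `(K \ J) ∪ A ∪ {∞}` where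
`J ⊆ K ∈ H` and `A ⊊ J`. -/
def blowUpStrata {I : Type u} [DecidableEq I] (H : Set (Finset I)) (J : Finset I) :
    Set (Finset (Option I)) :=
  {J' | ∃ L ∈ H, ¬ J ⊆ L ∧ J' = L.map Function.Embedding.some} ∪
  {J' | ∃ K ∈ H, J ⊆ K ∧ ∃ A : Finset I, A ⊂ J ∧ J' = Finset.insertNone ((K \ J) ∪ A)}

theorem mem_blowUpStrata_of_none_mem {I : Type u} [DecidableEq I] {H : Set (Finset I)}
    {J : Finset I} {J' : Finset (Option I)} (h : none ∈ J') :
    J' ∈ blowUpStrata H J ↔ J'.eraseNone ∪ J ∈ H ∧ ¬ J ⊆ J'.eraseNone := by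
  constructor
  · rintro (⟨L, _, _, rfl⟩ | ⟨K, hK, hJK, A, hA, rfl⟩)
    · simp at h
    · rw [Finset.eraseNone_insertNone]
      have e : K \ J ∪ A ∪ J = K := by
        ext x; have := @hJK x; have := @hA.1 x
        simp only [Finset.mem_union, Finset.mem_sdiff]; tauto
      refine ⟨by rw [e]; exact hK, fun hs => hA.2 fun x hx => ?_⟩
      have := hs hx
      simp only [Finset.mem_union, Finset.mem_sdiff] at this; tauto
  · rintro ⟨h1, h2⟩
    refine Or.inr ⟨_, h1, Finset.subset_union_right, J'.eraseNone ∩ J,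
      ⟨Finset.inter_subset_right, fun hs => h2 fun x hx => (Finset.mem_inter.1 (hs hx)).1⟩, ?_⟩
    ext x
    cases x with
    | none => simpa using h
    | some x =>
      simp only [Finset.some_mem_insertNone, Finset.mem_union, Finset.mem_sdiff, Finset.mem_inter,
        Finset.mem_eraseNone]
      tauto

theorem mem_blowUpStrata_of_none_notMem {I : Type u} [DecidableEq I] {H : Set (Finset I)}
    {J : Finset I} {J' : Finset (Option I)} (h : none ∉ J') :
    J' ∈ blowUpStrata H J ↔ J'.eraseNone ∈ H ∧ ¬ J ⊆ J'.eraseNone := by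
  constructor
  · rintro (⟨L, hL, hJ, rfl⟩ | ⟨K, _, _, A, _, rfl⟩)
    · rw [Finset.eraseNone_map_some]; exact ⟨hL, hJ⟩
    · simp at h
  · rintro ⟨h1, h2⟩
    refine Or.inl ⟨_, h1, h2, ?_⟩
    ext x
    cases x with
    | none => simpa using h
    | some x => simp

/-- The blow-up `π_J(F)` of the support fabric `F` centered in `J`. -/
def SupportFabric.blowUp {I : Type u} [DecidableEq I] (F : SupportFabric I) (J : Finset I) :
    SupportFabric (Option I) where
  strata := blowUpStrata F.strata J
  mem_of_subset := by
    intro J₁ J₂ h h₂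
    have he : J₁.eraseNone ⊆ J₂.eraseNone := fun x hx =>
      Finset.mem_eraseNone.2 (h (Finset.mem_eraseNone.1 hx))
    have key : ¬ J ⊆ J₂.eraseNone → ¬ J ⊆ J₁.eraseNone := fun hn hs => hn (hs.trans he)
    by_cases n₂ : none ∈ J₂
    · obtain ⟨a, b⟩ := (mem_blowUpStrata_of_none_mem n₂).1 h₂
      by_cases n₁ : none ∈ J₁
      · exact (mem_blowUpStrata_of_none_mem n₁).2
          ⟨F.mem_of_subset (Finset.union_subset_union_left he) a, key b⟩
      · exact (mem_blowUpStrata_of_none_notMem n₁).2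
          ⟨F.mem_of_subset (he.trans Finset.subset_union_left) a, key b⟩
    · obtain ⟨a, b⟩ := (mem_blowUpStrata_of_none_notMem n₂).1 h₂
      exact (mem_blowUpStrata_of_none_notMem fun n₁ => n₂ (h n₁)).2
        ⟨F.mem_of_subset he a, key b⟩

/-! ### Characteristic polyhedra -/

/-- The positive convex hull `[[A]]`, the convex hull of `A + ℝ_{≥0}^J`. -/
def posHull {ι : Type*} (A : Set (ι → ℝ)) : Set (ι → ℝ) :=
  convexHull ℝ (A + {τ : ι → ℝ | ∀ j, 0 ≤ τ j})

/-- `Δ` is a characteristic polyhedron with denominator `d`: `Δ = [[A]]` for some set `A` of points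
with coordinates in `(1/d) ℤ_{≥0}`. -/
def IsCharPolyhedron {ι : Type*} (d : ℕ) (Δ : Set (ι → ℝ)) : Prop :=
  ∃ A : Set (ι → ℝ), (∀ σ ∈ A, ∀ j, ∃ n : ℕ, σ j = (n : ℝ) / (d : ℝ)) ∧ Δ = posHull A

theorem subset_posHull {ι : Type*} (A : Set (ι → ℝ)) : A ⊆ posHull A := fun a ha =>
  subset_convexHull ℝ _ ⟨a, ha, 0, by simp, by simp⟩

theorem posHull_nonneg {ι : Type*} {A : Set (ι → ℝ)} (hA : ∀ σ ∈ A, ∀ j, 0 ≤ σ j) :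
    ∀ σ ∈ posHull A, ∀ j, 0 ≤ σ j := by
  intro σ hσ
  have hc : Convex ℝ {τ : ι → ℝ | ∀ j, 0 ≤ τ j} := fun x hx y hy a b ha hb _ j => by
    have := mul_nonneg ha (hx j)
    have := mul_nonneg hb (hy j)
    simp only [Pi.add_apply, Pi.smul_apply, smul_eq_mul]; linarith
  refine convexHull_min ?_ hc hσ
  rintro _ ⟨a, ha, t, ht, rfl⟩ j
  exact add_nonneg (hA a ha j) (ht j)

theorem IsCharPolyhedron.nonneg {ι : Type*} {d : ℕ} {Δ : Set (ι → ℝ)} (h : IsCharPolyhedron d Δ) :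
    ∀ σ ∈ Δ, ∀ j, 0 ≤ σ j := by
  obtain ⟨A, hA, rfl⟩ := h
  refine posHull_nonneg fun σ hσ j => ?_
  obtain ⟨n, hn⟩ := hA σ hσ j
  rw [hn]; positivity

theorem posHull_mono {ι : Type*} {A B : Set (ι → ℝ)} (h : A ⊆ B) : posHull A ⊆ posHull B :=
  convexHull_mono (Set.add_subset_add_right h)

theorem posHull_image_posHull {ι κ : Type*} (f : (ι → ℝ) →ₗ[ℝ] (κ → ℝ))
    (hf : ∀ τ : ι → ℝ, (∀ j, 0 ≤ τ j) → ∀ k, 0 ≤ f τ k) (A : Set (ι → ℝ)) :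
    posHull (f '' posHull A) = posHull (f '' A) := by
  refine Set.Subset.antisymm ?_ (posHull_mono (Set.image_mono (subset_posHull A)))
  refine convexHull_min ?_ (convex_convexHull ℝ _)
  have hadd : ∀ x ∈ posHull (f '' A), ∀ t : κ → ℝ, (∀ j, 0 ≤ t j) → x + t ∈ posHull (f '' A) := by
    intro x hx t ht
    have hc : Convex ℝ ((fun y => y + t) ⁻¹' posHull (f '' A)) :=
      (convex_convexHull ℝ _).translate_preimage_left t
    refine convexHull_min ?_ hc hx
    rintro _ ⟨a, ha, s, hs, rfl⟩
    exact subset_convexHull ℝ _ ⟨a, ha, s + t, fun j => add_nonneg (hs j) (ht j),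
      (add_assoc a s t).symm⟩
  have h1 : f '' posHull A ⊆ posHull (f '' A) := by
    unfold posHull
    rw [LinearMap.image_convexHull]
    refine convexHull_mono ?_
    rintro _ ⟨_, ⟨a, ha, t, ht, rfl⟩, rfl⟩
    exact ⟨f a, ⟨a, ha, rfl⟩, f t, hf t ht, (map_add f a t).symm⟩
  rintro _ ⟨x, hx, t, ht, rfl⟩
  exact hadd x (h1 hx) t ht

theorem posHull_posHull {ι : Type*} (A : Set (ι → ℝ)) : posHull (posHull A) = posHull A := by
  simpa using posHull_image_posHull (LinearMap.id : (ι → ℝ) →ₗ[ℝ] (ι → ℝ)) (fun _ h => h) A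

theorem image_posHull {ι κ : Type*} (f : (ι → ℝ) →ₗ[ℝ] (κ → ℝ))
    (hf : f '' {τ : ι → ℝ | ∀ j, 0 ≤ τ j} = {τ : κ → ℝ | ∀ j, 0 ≤ τ j}) (A : Set (ι → ℝ)) :
    f '' posHull A = posHull (f '' A) := by
  unfold posHull
  rw [LinearMap.image_convexHull, Set.image_add, hf]

theorem image_sub_posHull {ι : Type*} (e : ι → ℝ) (A : Set (ι → ℝ)) :
    (fun σ => σ - e) '' posHull A = posHull ((fun σ => σ - e) '' A) := by
  have h : ∀ B : Set (ι → ℝ), (fun σ => σ - e) '' B = (-e) +ᵥ B := fun B => by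
    simp only [sub_eq_neg_add]; rfl
  unfold posHull
  rw [h, h, ← convexHull_vadd]
  congr 1
  ext x
  simp only [Set.mem_vadd_set, Set.mem_add, vadd_eq_add]
  constructor
  · rintro ⟨_, ⟨a, ha, t, ht, rfl⟩, rfl⟩
    exact ⟨_, ⟨a, ha, rfl⟩, t, ht, by abel⟩
  · rintro ⟨_, ⟨a, ha, rfl⟩, t, ht, rfl⟩
    exact ⟨_, ⟨a, ha, t, ht, rfl⟩, by abel⟩

/-! ### Polyhedra systems, contact exponent and singular locus -/

/-- The contact exponent `δ(Δ)` of a (non-empty) polyhedron `Δ ⊆ ℝ_{≥0}^J`: the minimum of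
`|σ| = ∑ j, σ j` over `σ ∈ Δ` if `J ≠ ∅`, and `-1` by convention if `J = ∅`. -/
noncomputable def contactExponent {I : Type u} {J : Finset I} (Δ : Set (J → ℝ)) : ℝ :=
  open Classical in if J = ∅ then -1 else sInf ((fun σ : J → ℝ => ∑ j, σ j) '' Δ)

/-- A polyhedra system `(F; {Δ_J}_{J ∈ H}, d)`, all of whose polyhedra are non-empty. Only the
values of `Δ` at strata are meaningful. -/
structure PolyhedraSystem (I : Type u) where
  fabric : SupportFabric I
  d : ℕ
  d_pos : 0 < d
  Δ : ∀ J : Finset I, Set (J → ℝ)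
  isCharPolyhedron : ∀ J ∈ fabric.strata, IsCharPolyhedron d (Δ J)
  nonempty : ∀ J ∈ fabric.strata, (Δ J).Nonempty
  proj : ∀ (J₁ J₂ : Finset I) (h : J₁ ⊆ J₂), J₂ ∈ fabric.strata →
    Δ J₁ = Finset.restrict₂ (π := fun _ => ℝ) h '' Δ J₂

/-- The singular locus: the set of strata `J` with `δ(Δ_J) ≥ 1`. -/
def PolyhedraSystem.Sing {I : Type u} (D : PolyhedraSystem I) : Set (Finset I) :=
  {J | J ∈ D.fabric.strata ∧ 1 ≤ contactExponent (D.Δ J)}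

theorem IsCharPolyhedron.isLeast_contactExponent {I : Type u} {J : Finset I} {d : ℕ} (hd : 0 < d)
    {Δ : Set (J → ℝ)} (h : IsCharPolyhedron d Δ) (hne : Δ.Nonempty) (hJ : J ≠ ∅) :
    IsLeast ((fun σ : J → ℝ => ∑ j, σ j) '' Δ) (contactExponent Δ) := by
  have hδ : contactExponent Δ = sInf ((fun σ : J → ℝ => ∑ j, σ j) '' Δ) := if_neg hJ
  obtain ⟨A, hA, rfl⟩ := h
  have hAne : A.Nonempty := by
    by_contra hc
    rw [Set.not_nonempty_iff_eq_empty] at hc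
    subst hc
    simp [posHull] at hne
  have hdR : (0 : ℝ) < d := by exact_mod_cast hd
  have hnat : ∀ σ ∈ A, ∃ n : ℕ, ∑ j, σ j = (n : ℝ) / d := by
    intro σ hσ
    choose n hn using hA σ hσ
    exact ⟨∑ j, n j, by rw [Nat.cast_sum, Finset.sum_div]; exact Finset.sum_congr rfl fun j _ => hn j⟩
  classical
  have hex : ∃ n : ℕ, ∃ σ ∈ A, ∑ j, σ j = (n : ℝ) / d := by
    obtain ⟨σ, hσ⟩ := hAne
    obtain ⟨n, hn⟩ := hnat σ hσ
    exact ⟨n, σ, hσ, hn⟩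
  obtain ⟨σ₀, hσ₀, h₀⟩ := Nat.find_spec hex
  have hleast : IsLeast ((fun σ : J → ℝ => ∑ j, σ j) '' posHull A) (∑ j, σ₀ j) := by
    refine ⟨⟨σ₀, subset_posHull A hσ₀, rfl⟩, ?_⟩
    rintro _ ⟨σ, hσ, rfl⟩
    have hc : Convex ℝ {τ : J → ℝ | ∑ j, σ₀ j ≤ ∑ j, τ j} :=
      convex_halfSpace_ge (f := fun τ : J → ℝ => ∑ j, τ j)
        ⟨fun x y => by simp [Finset.sum_add_distrib], fun c x => by simp [Finset.mul_sum]⟩ _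
    refine convexHull_min ?_ hc hσ
    rintro _ ⟨a, ha, t, ht, rfl⟩
    obtain ⟨n, hn⟩ := hnat a ha
    have h1 : ∑ j, σ₀ j ≤ ∑ j, a j := by
      rw [h₀, hn]
      have : Nat.find hex ≤ n := Nat.find_min' hex ⟨a, ha, hn⟩
      gcongr
    have h2 : 0 ≤ ∑ j, t j := Finset.sum_nonneg fun j _ => ht j
    simp only [Set.mem_ofPred_eq, Pi.add_apply, Finset.sum_add_distrib]
    linarith
  rw [hδ, hleast.csInf_eq]
  exact hleast

theorem PolyhedraSystem.one_le_of_mem_Sing {I : Type u} {D : PolyhedraSystem I} {J : Finset I}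
    (hJ : J ∈ D.Sing) : ∀ σ ∈ D.Δ J, 1 ≤ ∑ j, σ j := by
  intro σ hσ
  have hne : J ≠ ∅ := by
    intro h
    have := hJ.2
    rw [contactExponent, if_pos h] at this
    linarith
  have := (D.isCharPolyhedron J hJ.1).isLeast_contactExponent D.d_pos (D.nonempty J hJ.1) hne
  exact hJ.2.trans (this.2 ⟨σ, hσ, rfl⟩)

/-! ### Transforms under blow-ups -/

/-- For `J' = (K \ J) ∪ A ∪ {∞}` with `J ⊆ K` and `A ⊊ J` (so that `K = (J' \ {∞}) ∪ J`), the map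
`λ_{J'} : ℝ^K → ℝ^{J'}` which keeps the coordinates other than `∞` and has
`λ_{J'}(σ)(∞) = ∑ j ∈ J, σ j`. -/
def lam {I : Type u} [DecidableEq I] (J : Finset I) (J' : Finset (Option I))
    (σ : ↥(J'.eraseNone ∪ J) → ℝ) : J' → ℝ
  | ⟨none, _⟩ => ∑ i : J, σ ⟨i.1, Finset.mem_union_right _ i.2⟩
  | ⟨some i, h⟩ => σ ⟨i, Finset.mem_union_left _ (Finset.mem_eraseNone.2 h)⟩

/-- Forgetting the coordinate `∞`; for `∞ ∉ J'` this is the identification of `ℝ^{J'}` for `J'` as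
a subset of `I ∪ {∞}` with `ℝ^{J'}` for `J'` as a subset of `I`. -/
def dropNone {I : Type u} (J' : Finset (Option I)) :
    (J' → ℝ) →ₗ[ℝ] (J'.eraseNone → ℝ) where
  toFun σ i := σ ⟨some i.1, Finset.mem_eraseNone.1 i.2⟩
  map_add' _ _ := rfl
  map_smul' _ _ := rfl

/-- The polyhedra `Δ⁰_{J'}` of the total transform centered in `J`: `Δ_{J'}` if `∞ ∉ J'` and
`[[λ_{J'}(Δ_K)]]`, `K = (J' \ {∞}) ∪ J`, if `∞ ∈ J'`. -/
def PolyhedraSystem.totalΔ {I : Type u} [DecidableEq I] (D : PolyhedraSystem I) (J : Finset I)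
    (J' : Finset (Option I)) : Set (J' → ℝ) :=
  if none ∈ J' then posHull (lam J J' '' D.Δ (J'.eraseNone ∪ J))
  else dropNone J' ⁻¹' D.Δ J'.eraseNone

/-- The vector `e_{J',∞}`, the restriction to `J'` of the `∞`-th vector of the standard basis. -/
def eInfty {I : Type u} (J' : Finset (Option I)) : J' → ℝ
  | ⟨none, _⟩ => 1
  | ⟨some _, _⟩ => 0

/-- The polyhedra `Δ'_{J'} = Δ⁰_{J'} - e_{J',∞}` of the characteristic transform centered in `J`. -/
def PolyhedraSystem.charΔ {I : Type u} [DecidableEq I] (D : PolyhedraSystem I) (J : Finset I)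
    (J' : Finset (Option I)) : Set (J' → ℝ) :=
  (fun σ => σ - eInfty J') '' D.totalΔ J J'

theorem dropNone_bijective {I : Type u} {J' : Finset (Option I)} (h : none ∉ J') :
    Function.Bijective (dropNone J') := by
  constructor
  · intro σ τ hst
    funext ⟨j, hj⟩
    cases j with
    | none => exact absurd hj h
    | some i => exact congrFun hst ⟨i, Finset.mem_eraseNone.2 hj⟩
  · intro σ
    refine ⟨fun j => match j with
      | ⟨none, _⟩ => 0
      | ⟨some i, hi⟩ => σ ⟨i, Finset.mem_eraseNone.2 hi⟩, ?_⟩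
    rfl

/-- `lam` as a linear map. -/
def lamLin {I : Type u} [DecidableEq I] (J : Finset I) (J' : Finset (Option I)) :
    (↥(J'.eraseNone ∪ J) → ℝ) →ₗ[ℝ] (J' → ℝ) where
  toFun := lam J J'
  map_add' σ τ := by
    funext ⟨j, hj⟩
    cases j with
    | none => simp [lam, Finset.sum_add_distrib]
    | some i => simp [lam]
  map_smul' c σ := by
    funext ⟨j, hj⟩
    cases j with
    | none => simp [lam, Finset.mul_sum]
    | some i => simp [lam]

theorem lamLin_nonneg {I : Type u} [DecidableEq I] (J : Finset I) (J' : Finset (Option I))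
    (τ : ↥(J'.eraseNone ∪ J) → ℝ) (hτ : ∀ j, 0 ≤ τ j) : ∀ k, 0 ≤ lamLin J J' τ k := by
  rintro ⟨j, hj⟩
  cases j with
  | none => exact Finset.sum_nonneg fun i _ => hτ _
  | some i => exact hτ _

/-- Restriction of functions from `J₂` to `J₁` as a linear map. -/
def restrictLin {I : Type u} {J₁ J₂ : Finset I} (h : J₁ ⊆ J₂) : (J₂ → ℝ) →ₗ[ℝ] (J₁ → ℝ) where
  toFun := Finset.restrict₂ (π := fun _ => ℝ) h
  map_add' _ _ := rfl
  map_smul' _ _ := rfl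

theorem restrictLin_image_nonneg {I : Type u} {J₁ J₂ : Finset I} (h : J₁ ⊆ J₂) :
    restrictLin h '' {τ : J₂ → ℝ | ∀ j, 0 ≤ τ j} = {τ : J₁ → ℝ | ∀ j, 0 ≤ τ j} := by
  classical
  ext τ
  constructor
  · rintro ⟨σ, hσ, rfl⟩ j
    exact hσ _
  · intro hτ
    refine ⟨fun j => if hj : j.1 ∈ J₁ then τ ⟨j.1, hj⟩ else 0, fun j => ?_, ?_⟩
    · by_cases hj : j.1 ∈ J₁
      · simpa [hj] using hτ _
      · simp [hj]
    · funext j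
      exact dif_pos j.2

theorem dropNone_image_nonneg {I : Type u} {J' : Finset (Option I)} :
    dropNone J' '' {τ : J' → ℝ | ∀ j, 0 ≤ τ j} = {τ : J'.eraseNone → ℝ | ∀ j, 0 ≤ τ j} := by
  ext τ
  constructor
  · rintro ⟨σ, hσ, rfl⟩ j
    exact hσ _
  · intro hτ
    refine ⟨fun j => match j with
      | ⟨none, _⟩ => 0
      | ⟨some i, hi⟩ => τ ⟨i, Finset.mem_eraseNone.2 hi⟩, ?_, rfl⟩
    rintro ⟨j, hj⟩
    cases j with
    | none => exact le_rfl
    | some i => exact hτ _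

theorem PolyhedraSystem.posHull_Δ {I : Type u} (D : PolyhedraSystem I) {J : Finset I}
    (hJ : J ∈ D.fabric.strata) : posHull (D.Δ J) = D.Δ J := by
  obtain ⟨A, -, h⟩ := D.isCharPolyhedron J hJ
  rw [h, posHull_posHull]

theorem PolyhedraSystem.totalΔ_proj {I : Type u} [DecidableEq I] (D : PolyhedraSystem I) (J : Finset I)
    (J₁ J₂ : Finset (Option I)) (h : J₁ ⊆ J₂)
    (h₂ : J₂ ∈ (D.fabric.blowUp J).strata) :
    D.totalΔ J J₁ = restrictLin h '' D.totalΔ J J₂ := by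
  have he : J₁.eraseNone ⊆ J₂.eraseNone := fun x hx =>
    Finset.mem_eraseNone.2 (h (Finset.mem_eraseNone.1 hx))
  by_cases n₂ : none ∈ J₂
  · have hK := ((mem_blowUpStrata_of_none_mem n₂).1 h₂).1
    by_cases n₁ : none ∈ J₁
    · rw [totalΔ, totalΔ, if_pos n₁, if_pos n₂, image_posHull _ (restrictLin_image_nonneg h),
        D.proj _ _ (Finset.union_subset_union_left he) hK, Set.image_image, Set.image_image]
      congr 2
      funext σ
      funext ⟨j, hj⟩
      cases j with
      | none => rfl
      | some i => rfl
    · rw [totalΔ, totalΔ, if_neg n₁, if_pos n₂]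
      apply Function.Injective.image_injective (dropNone_bijective n₁).1
      rw [Set.image_preimage_eq _ (dropNone_bijective n₁).2,
        image_posHull _ (restrictLin_image_nonneg h), image_posHull _ dropNone_image_nonneg]
      have hL := he.trans (Finset.subset_union_left (s₂ := J))
      rw [← D.posHull_Δ (D.fabric.mem_of_subset hL hK), D.proj _ _ hL hK, Set.image_image,
        Set.image_image]
      rfl
  · have n₁ : none ∉ J₁ := fun n₁ => n₂ (h n₁)
    have hL := ((mem_blowUpStrata_of_none_notMem n₂).1 h₂).1
    rw [totalΔ, totalΔ, if_neg n₁, if_neg n₂]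
    apply Function.Injective.image_injective (dropNone_bijective n₁).1
    rw [Set.image_preimage_eq _ (dropNone_bijective n₁).2, Set.image_image, D.proj _ _ he hL]
    conv_lhs => rw [← Set.image_preimage_eq (D.Δ J₂.eraseNone) (dropNone_bijective n₂).2,
      Set.image_image]
    rfl

theorem PolyhedraSystem.totalΔ_nonempty {I : Type u} [DecidableEq I] (D : PolyhedraSystem I) (J : Finset I)
    (J' : Finset (Option I)) (h : J' ∈ (D.fabric.blowUp J).strata) :
    (D.totalΔ J J').Nonempty := by
  by_cases n : none ∈ J'
  · have hK := ((mem_blowUpStrata_of_none_mem n).1 h).1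
    rw [totalΔ, if_pos n]
    exact ((D.nonempty _ hK).image _).mono (subset_posHull _)
  · have hL := ((mem_blowUpStrata_of_none_notMem n).1 h).1
    rw [totalΔ, if_neg n]
    exact (D.nonempty _ hL).preimage (dropNone_bijective n).2

theorem PolyhedraSystem.charΔ_isCharPolyhedron {I : Type u} [DecidableEq I] (D : PolyhedraSystem I)
    (J : Finset I) (hJ : J ∈ D.Sing) (J' : Finset (Option I))
    (h : J' ∈ (D.fabric.blowUp J).strata) : IsCharPolyhedron D.d (D.charΔ J J') := by
  have hd : (0 : ℝ) < D.d := by exact_mod_cast D.d_pos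
  by_cases n : none ∈ J'
  · have hK := ((mem_blowUpStrata_of_none_mem n).1 h).1
    obtain ⟨A, hA, hΔ⟩ := D.isCharPolyhedron _ hK
    refine ⟨(fun σ => σ - eInfty J') '' (lam J J' '' A), ?_, ?_⟩
    · rintro _ ⟨_, ⟨a, ha, rfl⟩, rfl⟩ ⟨j, hj⟩
      choose m hm using hA a ha
      cases j with
      | none =>
        have hmem : Finset.restrict₂ (π := fun _ => ℝ) Finset.subset_union_right a ∈ D.Δ J := by
          rw [D.proj _ _ Finset.subset_union_right hK]
          exact ⟨a, hΔ ▸ subset_posHull A ha, rfl⟩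
        have h1 : 1 ≤ ∑ i : J, a ⟨i.1, Finset.mem_union_right _ i.2⟩ :=
          D.one_le_of_mem_Sing hJ _ hmem
        have h2 : ∑ i : J, a ⟨i.1, Finset.mem_union_right _ i.2⟩ =
            ((∑ i : J, m ⟨i.1, Finset.mem_union_right _ i.2⟩ : ℕ) : ℝ) / D.d := by
          rw [Nat.cast_sum, Finset.sum_div]
          exact Finset.sum_congr rfl fun i _ => hm _
        rw [h2, le_div_iff₀ hd, one_mul] at h1
        have h3 := Nat.cast_le.1 h1
        refine ⟨(∑ i : J, m ⟨i.1, Finset.mem_union_right _ i.2⟩) - D.d, ?_⟩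
        rw [Nat.cast_sub h3, sub_div, ← h2, div_self hd.ne']
        rfl
      | some i =>
        refine ⟨m ⟨i, Finset.mem_union_left _ (Finset.mem_eraseNone.2 hj)⟩, ?_⟩
        rw [← hm]
        simp [lam, eInfty]
    · rw [charΔ, totalΔ, if_pos n, hΔ, ← image_sub_posHull]
      congr 1
      exact posHull_image_posHull (lamLin J J') (lamLin_nonneg J J') A
  · have hL := ((mem_blowUpStrata_of_none_notMem n).1 h).1
    obtain ⟨A, hA, hΔ⟩ := D.isCharPolyhedron _ hL
    have e0 : eInfty J' = 0 := by
      funext ⟨j, hj⟩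
      cases j with
      | none => exact absurd hj n
      | some i => rfl
    refine ⟨dropNone J' ⁻¹' A, ?_, ?_⟩
    · rintro σ hσ ⟨j, hj⟩
      cases j with
      | none => exact absurd hj n
      | some i => exact hA _ hσ ⟨i, Finset.mem_eraseNone.2 hj⟩
    · rw [charΔ, totalΔ, if_neg n, e0]
      simp only [sub_zero, Set.image_id']
      apply Function.Injective.image_injective (dropNone_bijective n).1
      rw [image_posHull _ dropNone_image_nonneg, Set.image_preimage_eq _ (dropNone_bijective n).2,
        Set.image_preimage_eq _ (dropNone_bijective n).2, hΔ]

theorem PolyhedraSystem.charΔ_proj {I : Type u} [DecidableEq I] (D : PolyhedraSystem I) (J : Finset I)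
    (J₁ J₂ : Finset (Option I)) (h : J₁ ⊆ J₂)
    (h₂ : J₂ ∈ (D.fabric.blowUp J).strata) :
    D.charΔ J J₁ = restrictLin h '' D.charΔ J J₂ := by
  rw [charΔ, charΔ, D.totalΔ_proj J J₁ J₂ h h₂, Set.image_image, Set.image_image]
  congr 1
  funext σ
  rw [map_sub]
  congr 1
  funext ⟨j, hj⟩
  cases j with
  | none => rfl
  | some i => rfl

/-- The characteristic transform `Λ_J(D)` of `D` centered in a singular stratum `J`. -/
def PolyhedraSystem.charTransform {I : Type u} [DecidableEq I] (D : PolyhedraSystem I) (J : Finset I)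
    (hJ : J ∈ D.Sing) : PolyhedraSystem (Option I) where
  fabric := D.fabric.blowUp J
  d := D.d
  d_pos := D.d_pos
  Δ := D.charΔ J
  isCharPolyhedron := D.charΔ_isCharPolyhedron J hJ
  nonempty J' h := (D.totalΔ_nonempty J J' h).image _
  proj J₁ J₂ h h₂ := D.charΔ_proj J J₁ J₂ h h₂

/-- `FiniteCharSeq D D'`: there is a finite sequence `D → D₁ → ⋯ → D_k = D'` (`k ≥ 0`) of
characteristic transforms, each centered in a singular stratum of the preceding system. -/
inductive FiniteCharSeq {I : Type u} [DecidableEq I] (D : PolyhedraSystem I) :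
    ∀ {I' : Type u} [DecidableEq I'], PolyhedraSystem I' → Prop
  | refl : FiniteCharSeq D D
  | step {I' : Type u} [DecidableEq I'] {D' : PolyhedraSystem I'} (h : FiniteCharSeq D D')
      (J : Finset I') (hJ : J ∈ D'.Sing) : FiniteCharSeq D (D'.charTransform J hJ)

end PolyhedraSystems

/-!
Only the points `σ = a / d` of the polyhedra with `a` integral matter. In terms of the exponents
`a`, the characteristic transform centered in `J` adjoins the coordinate `∑ j ∈ J, a j - d`, which
is the transformation law of the exponents of a monomial ideal with assigned order `d`. So the
classical resolution of idealistic exponents applies, by induction on a bound for the number of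
elements of the singular strata.

Write the system as a product of a monomial `x^ω` and a system `N` whose order along the singular
locus is at most `r`, and descend on `r`. If `r = 0`, the system is monomial, and blowing up minimal
singular strata decreases the multiset of the orders of `x^ω` along the singular strata in the
Dershowitz–Manna ordering. If `r > 0`, the companion system generated by `N^m` and `(x^ω N)^r`, with
denominator `m r`, is singular exactly where the given system is singular and `N` has order at
least `r`; resolving it therefore lowers `r`. Its order along its singular strata is `m r`, the
smallest possible value, so each of them lies in a hypersurface of maximal contact, and this
persists under blow-ups. The singular strata of the coefficient system on such a hypersurface are
smaller by one element, so it is resolvable by induction, and once it is resolved the hypersurface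
is not needed any more.
-/

namespace PolyhedraSystems

open Finset

/-! ### Strata of a blow-up -/

theorem eq_map_some_or_eq_insertNone {I : Type*} (J' : Finset (Option I)) :
    (∃ L : Finset I, J' = L.map .some) ∨ ∃ L : Finset I, J' = insertNone L := by
  classical
  by_cases h : none ∈ J'
  · exact Or.inr ⟨J'.eraseNone, by rw [insertNone_eraseNone, insert_eq_of_mem h]⟩
  · exact Or.inl ⟨J'.eraseNone, by rw [map_some_eraseNone, erase_eq_of_notMem h]⟩

section BlowDown

variable {I : Type u} [DecidableEq I] {J L : Finset I} {J' : Finset (Option I)}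

/-- The image, in the original fabric, of the stratum `J'` of its blow-up centered in `J`. -/
def blowDown (J : Finset I) (J' : Finset (Option I)) : Finset I :=
  if none ∈ J' then J'.eraseNone ∪ J else J'.eraseNone

theorem mem_blowDown {i : I} : i ∈ blowDown J J' ↔ some i ∈ J' ∨ none ∈ J' ∧ i ∈ J := by
  by_cases h : none ∈ J' <;> simp [blowDown, h]

theorem blowDown_of_none_mem (h : none ∈ J') : blowDown J J' = J'.eraseNone ∪ J := if_pos h

theorem blowDown_of_none_notMem (h : none ∉ J') : blowDown J J' = J'.eraseNone := if_neg h

@[simp]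
theorem blowDown_map_some : blowDown J (L.map .some) = L := by
  simp [blowDown]

@[simp]
theorem blowDown_insertNone : blowDown J (insertNone L) = L ∪ J := by
  simp [blowDown]

theorem blowDown_insert_some (i : I) :
    blowDown (insert i J) (insert (some i) J') = insert i (blowDown J J') := by
  ext x
  simp only [mem_blowDown, mem_insert, Option.some.injEq, reduceCtorEq, false_or]
  tauto

theorem eraseNone_subset_blowDown : J'.eraseNone ⊆ blowDown J J' := fun _ hi =>
  mem_blowDown.2 (Or.inl (mem_eraseNone.1 hi))

theorem subset_blowDown (h : none ∈ J') : J ⊆ blowDown J J' := fun _ hi =>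
  mem_blowDown.2 (Or.inr ⟨h, hi⟩)

theorem blowDown_mono {J₁ J₂ : Finset (Option I)} (h : J₁ ⊆ J₂) :
    blowDown J J₁ ⊆ blowDown J J₂ := fun i => by
  simpa only [mem_blowDown] using Or.imp (fun hi => h hi) (And.imp_left fun hn => h hn)

theorem subset_insertNone_blowDown : J' ⊆ insertNone (blowDown J J') := by
  rintro (_ | i) hi
  · exact none_mem_insertNone
  · exact some_mem_insertNone.2 (mem_blowDown.2 (Or.inl hi))

theorem SupportFabric.mem_blowUp {F : SupportFabric I} :
    J' ∈ (F.blowUp J).strata ↔ blowDown J J' ∈ F.strata ∧ ¬ J ⊆ J'.eraseNone := by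
  by_cases h : none ∈ J'
  · rw [blowDown_of_none_mem h]; exact mem_blowUpStrata_of_none_mem h
  · rw [blowDown_of_none_notMem h]; exact mem_blowUpStrata_of_none_notMem h

theorem card_le_card_blowDown (h : ¬ J ⊆ J'.eraseNone) : J'.card ≤ (blowDown J J').card := by
  obtain ⟨L, rfl⟩ | ⟨L, rfl⟩ := eq_map_some_or_eq_insertNone J'
  · simp
  · rw [eraseNone_insertNone] at h
    have : L ⊂ L ∪ J := ⟨subset_union_left, fun hL => h (subset_union_right.trans hL)⟩
    simpa using card_lt_card this

end BlowDown

/-! ### Sets of exponents -/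

/-- The inclusion, in the variables indexed by `K`, of the monomial ideal generated by the
exponents in `A` into the one generated by those in `B`. -/
def IdealLE {I : Type*} (K : Finset I) (A B : Set (I → ℕ)) : Prop :=
  ∀ a ∈ A, ∃ b ∈ B, ∀ k ∈ K, b k ≤ a k

/-- In the variables indexed by `K`, the exponents in `A` and those in `B` generate the same
monomial ideal. -/
def IdealEq {I : Type*} (K : Finset I) (A B : Set (I → ℕ)) : Prop :=
  IdealLE K A B ∧ IdealLE K B A

section Ideal

variable {I κ : Type*} {K : Finset I} {M : Finset κ} {A B C A' B' : Set (I → ℕ)}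
  {f g : (I → ℕ) → κ → ℕ} {m : ℕ}

theorem IdealLE.refl (K : Finset I) (A : Set (I → ℕ)) : IdealLE K A A := fun a ha =>
  ⟨a, ha, fun _ _ => le_rfl⟩

theorem IdealLE.trans (h : IdealLE K A B) (h' : IdealLE K B C) : IdealLE K A C := by
  intro a ha
  obtain ⟨b, hb, hab⟩ := h a ha
  obtain ⟨c, hc, hbc⟩ := h' b hb
  exact ⟨c, hc, fun k hk => (hbc k hk).trans (hab k hk)⟩

theorem IdealLE.union (h : IdealLE K A B) (h' : IdealLE K A' B') :
    IdealLE K (A ∪ A') (B ∪ B') := by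
  rintro a (ha | ha)
  · exact (h a ha).imp fun _ hb => ⟨Or.inl hb.1, hb.2⟩
  · exact (h' a ha).imp fun _ hb => ⟨Or.inr hb.1, hb.2⟩

theorem IdealLE.image (h : IdealLE K A B)
    (hf : ∀ a b, (∀ k ∈ K, b k ≤ a k) → ∀ j ∈ M, f b j ≤ f a j) :
    IdealLE M (f '' A) (f '' B) := by
  rintro _ ⟨a, ha, rfl⟩
  obtain ⟨b, hb, hab⟩ := h a ha
  exact ⟨_, ⟨b, hb, rfl⟩, hf a b hab⟩

theorem IdealLE.le_sum (h : IdealLE K A B) (hB : ∀ b ∈ B, m ≤ ∑ k ∈ K, b k) :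
    ∀ a ∈ A, m ≤ ∑ k ∈ K, a k := by
  intro a ha
  obtain ⟨b, hb, hab⟩ := h a ha
  exact (hB b hb).trans (sum_le_sum hab)

theorem IdealEq.refl (K : Finset I) (A : Set (I → ℕ)) : IdealEq K A A := ⟨.refl K A, .refl K A⟩

theorem IdealEq.trans (h : IdealEq K A B) (h' : IdealEq K B C) : IdealEq K A C :=
  ⟨h.1.trans h'.1, h'.2.trans h.2⟩

theorem IdealEq.union (h : IdealEq K A B) (h' : IdealEq K A' B') :
    IdealEq K (A ∪ A') (B ∪ B') :=
  ⟨h.1.union h'.1, h.2.union h'.2⟩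

theorem IdealEq.image (h : IdealEq K A B)
    (hf : ∀ a b, (∀ k ∈ K, b k ≤ a k) → ∀ j ∈ M, f b j ≤ f a j) :
    IdealEq M (f '' A) (f '' B) :=
  ⟨h.1.image hf, h.2.image hf⟩

theorem idealEq_image (hfg : ∀ a ∈ A, ∀ j ∈ M, f a j = g a j) : IdealEq M (f '' A) (g '' A) := by
  constructor <;> rintro _ ⟨a, ha, rfl⟩
  · exact ⟨_, ⟨a, ha, rfl⟩, fun j hj => (hfg a ha j hj).ge⟩
  · exact ⟨_, ⟨a, ha, rfl⟩, fun j hj => (hfg a ha j hj).le⟩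

theorem IdealEq.le_sum_iff (h : IdealEq K A B) :
    (∀ a ∈ A, m ≤ ∑ k ∈ K, a k) ↔ ∀ b ∈ B, m ≤ ∑ k ∈ K, b k :=
  ⟨h.2.le_sum, h.1.le_sum⟩

end Ideal

/-! ### Exponent systems and their transforms -/

/-- A discrete model of a polyhedra system: each stratum `K` carries a non-empty set of exponents,
of which only the coordinates in `K` are meaningful. A common denominator of the exponents is not
part of the data. -/
structure ExponentSystem (I : Type u) where
  fabric : SupportFabric I
  exps : Finset I → Set (I → ℕ)
  nonempty : ∀ K ∈ fabric.strata, (exps K).Nonempty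
  idealEq : ∀ ⦃J K : Finset I⦄, J ⊆ K → K ∈ fabric.strata → IdealEq J (exps J) (exps K)

/-- The singular locus of an exponent system with respect to the denominator `m`. -/
def ExponentSystem.Sing {I : Type u} (m : ℕ) (X : ExponentSystem I) : Set (Finset I) :=
  {K | K ∈ X.fabric.strata ∧ ∀ a ∈ X.exps K, m ≤ ∑ k ∈ K, a k}

/-- The transform of an exponent under a blow-up centered in `J`, with denominator `m`. The
subtraction truncates unless the order along `J` is at least `m`. -/
def transformExp {I : Type u} (m : ℕ) (J : Finset I) (a : I → ℕ) : Option I → ℕ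
  | none => ∑ j ∈ J, a j - m
  | some i => a i

section Transform

variable {I : Type u} {m r : ℕ} {J K : Finset I} {J' : Finset (Option I)} {X : ExponentSystem I}

@[simp]
theorem transformExp_none (a : I → ℕ) : transformExp m J a none = ∑ j ∈ J, a j - m := rfl

@[simp]
theorem transformExp_some (a : I → ℕ) (i : I) : transformExp m J a (some i) = a i := rfl

theorem ExponentSystem.le_sum_of_subset (hJ : J ∈ X.Sing m) (hJK : J ⊆ K)
    (hK : K ∈ X.fabric.strata) : ∀ a ∈ X.exps K, m ≤ ∑ j ∈ J, a j :=
  (X.idealEq hJK hK).le_sum_iff.1 hJ.2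

theorem ExponentSystem.mem_sing_of_subset (hJ : J ∈ X.Sing m) (hJK : J ⊆ K)
    (hK : K ∈ X.fabric.strata) : K ∈ X.Sing m :=
  ⟨hK, fun a ha => (X.le_sum_of_subset hJ hJK hK a ha).trans (sum_le_sum_of_subset hJK)⟩

theorem sum_eq_and_eq_zero_of_le {a : I → ℕ} (hJK : J ⊆ K) (h₁ : r ≤ ∑ j ∈ J, a j)
    (h₂ : ∑ k ∈ K, a k ≤ r) : ∑ j ∈ J, a j = r ∧ ∀ k ∈ K, k ∉ J → a k = 0 := by
  classical
  have hsum := sum_sdiff (f := a) hJK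
  refine ⟨by omega, fun k hk hkJ => ?_⟩
  have hzero : ∑ k ∈ K \ J, a k = 0 := by omega
  exact sum_eq_zero_iff.1 hzero k (mem_sdiff.2 ⟨hk, hkJ⟩)

variable [DecidableEq I]

theorem transformExp_mono (a b : I → ℕ) (h : ∀ k ∈ blowDown J J', b k ≤ a k) :
    ∀ k ∈ J', transformExp m J b k ≤ transformExp m J a k := by
  rintro (_ | i) hk
  · exact Nat.sub_le_sub_right (sum_le_sum fun j hj => h j (subset_blowDown hk hj)) m
  · exact h i (eraseNone_subset_blowDown (mem_eraseNone.2 hk))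

/-- The characteristic transform of an exponent system centered in `J`, with denominator `m`. -/
def ExponentSystem.blowUp (m : ℕ) (J : Finset I) (X : ExponentSystem I) :
    ExponentSystem (Option I) where
  fabric := X.fabric.blowUp J
  exps J' := transformExp m J '' X.exps (blowDown J J')
  nonempty _ h := (X.nonempty _ (SupportFabric.mem_blowUp.1 h).1).image _
  idealEq _ _ h h₂ :=
    (X.idealEq (blowDown_mono h) (SupportFabric.mem_blowUp.1 h₂).1).image transformExp_mono

theorem ExponentSystem.map_some_mem_sing_blowUp :
    K.map .some ∈ (X.blowUp m J).Sing m ↔ K ∈ X.Sing m ∧ ¬ J ⊆ K := by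
  simp only [Sing, blowUp, Set.mem_ofPred_eq, SupportFabric.mem_blowUp, blowDown_map_some,
    eraseNone_map_some, Set.forall_mem_image, sum_map, Function.Embedding.some_apply,
    transformExp_some]
  tauto

theorem ExponentSystem.blowDown_mem_sing (hJ : J ∈ X.Sing m)
    (hJ' : J' ∈ (X.blowUp m J).Sing m) : blowDown J J' ∈ X.Sing m := by
  obtain ⟨L, rfl⟩ | ⟨L, rfl⟩ := eq_map_some_or_eq_insertNone J'
  · rw [blowDown_map_some]
    exact (map_some_mem_sing_blowUp.1 hJ').1
  · exact mem_sing_of_subset hJ (subset_blowDown none_mem_insertNone)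
      (SupportFabric.mem_blowUp.1 hJ'.1).1

theorem sum_transformExp_le {a : I → ℕ} (hr : none ∈ J' → r ≤ ∑ j ∈ J, a j)
    (h : ∑ k ∈ blowDown J J', a k ≤ r) :
    ∑ k ∈ J', transformExp r J a k ≤ ∑ i ∈ J'.eraseNone, a i := by
  obtain ⟨L, rfl⟩ | ⟨L, rfl⟩ := eq_map_some_or_eq_insertNone J'
  · simp
  · have hJ := (sum_eq_and_eq_zero_of_le (subset_blowDown none_mem_insertNone)
      (hr none_mem_insertNone) h).1
    simp [sum_insertNone, hJ]

end Transform

/-! ### Equivalence, bounds and resolvability -/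

/-- Two exponent systems on the same fabric whose exponents generate the same monomial ideal on
every stratum. -/
structure ExponentSystem.Equivalent {I : Type u} (X Y : ExponentSystem I) : Prop where
  strata_eq : X.fabric.strata = Y.fabric.strata
  idealEq : ∀ K ∈ X.fabric.strata, IdealEq K (X.exps K) (Y.exps K)

/-- The singular locus is finite and consists of strata with at most `n` elements. -/
structure ExponentSystem.SingBounded {I : Type u} (m n : ℕ) (X : ExponentSystem I) : Prop where
  finite : (X.Sing m).Finite
  card_le : ∀ K ∈ X.Sing m, K.card ≤ n

section Equivalent

variable {I : Type u} {m n : ℕ} {X Y Z : ExponentSystem I} {J : Finset I}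

theorem ExponentSystem.Equivalent.refl (X : ExponentSystem I) : X.Equivalent X :=
  ⟨rfl, fun _ _ => .refl _ _⟩

theorem ExponentSystem.Equivalent.trans (h : X.Equivalent Y) (h' : Y.Equivalent Z) :
    X.Equivalent Z :=
  ⟨h.strata_eq.trans h'.strata_eq, fun K hK =>
    (h.idealEq K hK).trans (h'.idealEq K (h.strata_eq ▸ hK))⟩

theorem ExponentSystem.Equivalent.sing_eq (h : X.Equivalent Y) : X.Sing m = Y.Sing m := by
  ext K
  rw [Sing, Sing, Set.mem_ofPred_eq, Set.mem_ofPred_eq, ← h.strata_eq]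
  exact and_congr_right fun hK => (h.idealEq K hK).le_sum_iff

theorem ExponentSystem.SingBounded.of_sing_subset {m' : ℕ} (h : Y.SingBounded m n)
    (hsub : X.Sing m' ⊆ Y.Sing m) : X.SingBounded m' n :=
  ⟨h.finite.subset hsub, fun _ hK => h.card_le _ (hsub hK)⟩

variable [DecidableEq I]

theorem ExponentSystem.Equivalent.blowUp (h : X.Equivalent Y) :
    (X.blowUp m J).Equivalent (Y.blowUp m J) where
  strata_eq := congrArg (blowUpStrata · J) h.strata_eq
  idealEq _ hK := (h.idealEq _ (SupportFabric.mem_blowUp.1 hK).1).image transformExp_mono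

theorem ExponentSystem.SingBounded.blowUp (h : X.SingBounded m n) (hJ : J ∈ X.Sing m) :
    (X.blowUp m J).SingBounded m n where
  finite := (h.finite.biUnion fun K _ => (insertNone K).powerset.finite_toSet).subset
    fun _ hJ' => Set.mem_biUnion (blowDown_mem_sing hJ hJ')
      (mem_coe.2 (mem_powerset.2 subset_insertNone_blowDown))
  card_le _ hJ' := (card_le_card_blowDown (SupportFabric.mem_blowUp.1 hJ'.1).2).trans
    (h.card_le _ (blowDown_mem_sing hJ hJ'))

end Equivalent

/-- The exponent system can be made non-singular by finitely many characteristic transforms. -/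
inductive Resolvable (m : ℕ) : ∀ {I : Type u} [DecidableEq I], ExponentSystem I → Prop
  | of_sing_eq_empty {I : Type u} [DecidableEq I] (X : ExponentSystem I) (h : X.Sing m = ∅) :
      Resolvable m X
  | of_blowUp {I : Type u} [DecidableEq I] (X : ExponentSystem I) (J : Finset I)
      (hJ : J ∈ X.Sing m) (h : Resolvable m (X.blowUp m J)) : Resolvable m X

theorem Resolvable.lift {m m' : ℕ}
    (Rel : ∀ {I : Type u} [DecidableEq I], ExponentSystem I → ExponentSystem I → Prop)
    (step : ∀ {I : Type u} [DecidableEq I] (X Y : ExponentSystem I) (J : Finset I), Rel X Y →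
      J ∈ X.Sing m → ∃ J' ∈ Y.Sing m', Rel (X.blowUp m J) (Y.blowUp m' J'))
    (final : ∀ {I : Type u} [DecidableEq I] (X Y : ExponentSystem I), Rel X Y → X.Sing m = ∅ →
      Resolvable m' Y)
    {I : Type u} [DecidableEq I] {X : ExponentSystem I} (hX : Resolvable m X) :
    ∀ {Y : ExponentSystem I}, Rel X Y → Resolvable m' Y := by
  induction hX with
  | of_sing_eq_empty X h => exact fun hR => final _ _ hR h
  | of_blowUp X J hJ _ ih =>
    intro Y hR
    obtain ⟨J', hJ', hR'⟩ := step _ _ _ hR hJ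
    exact .of_blowUp _ J' hJ' (ih hR')

/-! ### Monomial systems -/

/-- Locally principal exponent systems: on all strata the exponents are multiples of the monomial
`ω`, and along the singular locus they generate the same ideal as `ω`. -/
structure ExponentSystem.IsMonomial {I : Type u} (m : ℕ) (X : ExponentSystem I) (ω : I → ℕ) :
    Prop where
  le : ∀ K ∈ X.fabric.strata, IdealLE K (X.exps K) {ω}
  ge : ∀ K ∈ X.Sing m, IdealLE K {ω} (X.exps K)

section Monomial

theorem isDershowitzMannaLT_map_val {α β ι : Type*} [Preorder ι] {S : Finset α} {S' : Finset β}
    {f : α → ι} {g : β → ι} {p : α → Prop} (e : α ↪ β)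
    (mem_iff : ∀ x, e x ∈ S' ↔ x ∈ S ∧ ¬ p x) (map_eq : ∀ x, g (e x) = f x)
    (exists_removed : ∃ x ∈ S, p x)
    (lt_removed : ∀ y ∈ S', y ∉ Set.range e → ∃ x ∈ S, p x ∧ g y < f x) :
    (S'.val.map g).IsDershowitzMannaLT (S.val.map f) := by
  classical
  have hkept : S'.filter (· ∈ Set.range e) = (S.filter (¬ p ·)).map e := by
    ext y
    simp only [mem_filter, mem_map, ← mem_iff, Set.mem_range]
    constructor
    · rintro ⟨hy, x, rfl⟩
      exact ⟨x, hy, rfl⟩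
    · rintro ⟨x, hx, rfl⟩
      exact ⟨hx, x, rfl⟩
  refine ⟨(S.filter (¬ p ·)).val.map f, (S'.filter (· ∉ Set.range e)).val.map g,
    (S.filter p).val.map f, ?_, ?_, ?_, ?_⟩
  · obtain ⟨x, hx, hpx⟩ := exists_removed
    rw [Multiset.empty_eq_zero, Ne, Multiset.map_eq_zero, val_eq_zero]
    exact ne_empty_of_mem (mem_filter.2 ⟨hx, hpx⟩)
  · have hf : (S.filter (¬ p ·)).val.map f = (S'.filter (· ∈ Set.range e)).val.map g := by
      rw [hkept, map_val, Multiset.map_map]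
      exact Multiset.map_congr rfl fun x _ => (map_eq x).symm
    rw [hf, ← Multiset.map_add, filter_val, filter_val, Multiset.filter_add_not]
  · rw [← Multiset.map_add, filter_val, filter_val, add_comm, Multiset.filter_add_not]
  · simp only [Multiset.mem_map, mem_val, mem_filter]
    rintro _ ⟨y, ⟨hy, hye⟩, rfl⟩
    obtain ⟨x, hx, hpx, hlt⟩ := lt_removed y hy hye
    exact ⟨_, ⟨x, ⟨hx, hpx⟩, rfl⟩, hlt⟩

variable {I : Type u} {m n : ℕ} {X : ExponentSystem I} {ω : I → ℕ}

theorem ExponentSystem.IsMonomial.mem_sing_iff (h : X.IsMonomial m ω) {K : Finset I}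
    (hK : K ∈ X.fabric.strata) : K ∈ X.Sing m ↔ m ≤ ∑ k ∈ K, ω k :=
  ⟨fun hS => (h.ge K hS).le_sum hS.2 ω rfl,
    fun hm => ⟨hK, (h.le K hK).le_sum fun _ hb => hb ▸ hm⟩⟩

variable [DecidableEq I]

theorem ExponentSystem.IsMonomial.blowUp (h : X.IsMonomial m ω) {J : Finset I}
    (hJ : J ∈ X.Sing m) : (X.blowUp m J).IsMonomial m (transformExp m J ω) where
  le _ hK' := by
    rw [← Set.image_singleton]
    exact (h.le _ (SupportFabric.mem_blowUp.1 hK').1).image transformExp_mono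
  ge _ hK' := by
    rw [← Set.image_singleton]
    exact (h.ge _ (blowDown_mem_sing hJ hK')).image transformExp_mono

theorem sum_transformExp_insertNone_lt {J L : Finset I} (hJL : ¬ J ⊆ L) (hJ : m ≤ ∑ j ∈ J, ω j)
    (hmin : ∀ j ∈ J, ∑ i ∈ J.erase j, ω i < m) :
    ∑ k ∈ insertNone L, transformExp m J ω k < ∑ k ∈ L ∪ J, ω k := by
  obtain ⟨j, hjJ, hjL⟩ := not_subset.1 hJL
  have hsub : insert j L ⊆ L ∪ J :=
    insert_subset (mem_union_right L hjJ) subset_union_left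
  have hL : ω j + ∑ k ∈ L, ω k ≤ ∑ k ∈ L ∪ J, ω k := by
    rw [← sum_insert hjL]
    exact sum_le_sum_of_subset hsub
  have hJj := add_sum_erase J ω hjJ
  have := hmin j hjJ
  simp only [sum_insertNone, transformExp_none, transformExp_some]
  omega

theorem ExponentSystem.IsMonomial.sum_erase_lt (h : X.IsMonomial m ω) {J : Finset I}
    (hJ : Minimal (· ∈ X.Sing m) J) {j : I} (hj : j ∈ J) : ∑ i ∈ J.erase j, ω i < m := by
  by_contra! hle
  have hsub := erase_subset j J
  have herase : J.erase j ∈ X.Sing m :=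
    (h.mem_sing_iff (X.fabric.mem_of_subset hsub hJ.prop.1)).2 hle
  exact notMem_erase j J (hJ.le_of_le herase hsub hj)

/-- The multiset of the orders of the monomial `ω` along the singular strata, which decreases when
a minimal singular stratum of a monomial system is blown up. -/
noncomputable def ExponentSystem.SingBounded.orders (h : X.SingBounded m n) (ω : I → ℕ) :
    Multiset ℕ :=
  h.finite.toFinset.val.map fun K => ∑ k ∈ K, ω k

theorem ExponentSystem.IsMonomial.orders_blowUp_lt (h : X.IsMonomial m ω)
    (hb : X.SingBounded m n) {J : Finset I} (hJ : Minimal (· ∈ X.Sing m) J) :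
    ((hb.blowUp hJ.prop).orders (transformExp m J ω)).IsDershowitzMannaLT (hb.orders ω) := by
  refine isDershowitzMannaLT_map_val (mapEmbedding .some).toEmbedding (p := (J ⊆ ·)) (fun K => ?_)
    (fun K => sum_map K _ _) ⟨J, by simpa using hJ.prop, Subset.rfl⟩ fun K' hK' hK'e => ?_
  · simpa using map_some_mem_sing_blowUp
  · rw [Set.Finite.mem_toFinset] at hK'
    obtain ⟨L, rfl⟩ | ⟨L, rfl⟩ := eq_map_some_or_eq_insertNone K'
    · exact absurd ⟨L, rfl⟩ hK'e
    · have hJL := (SupportFabric.mem_blowUp.1 hK'.1).2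
      have hL := blowDown_mem_sing hJ.prop hK'
      rw [blowDown_insertNone] at hL
      rw [eraseNone_insertNone] at hJL
      exact ⟨L ∪ J, (Set.Finite.mem_toFinset _).2 hL, subset_union_right,
        sum_transformExp_insertNone_lt hJL ((h.mem_sing_iff hJ.prop.1).1 hJ.prop)
          fun j hj => h.sum_erase_lt hJ hj⟩

end Monomial

theorem ExponentSystem.IsMonomial.resolvable {m n : ℕ} {I : Type u} [DecidableEq I]
    {X : ExponentSystem I} {ω : I → ℕ} (h : X.IsMonomial m ω) (hb : X.SingBounded m n) :
    Resolvable m X := by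
  induction hM : hb.orders ω using
      (Multiset.wellFounded_isDershowitzMannaLT (α := ℕ)).induction generalizing I with
  | _ M ih =>
    subst hM
    obtain hempty | hne := (X.Sing m).eq_empty_or_nonempty
    · exact .of_sing_eq_empty X hempty
    obtain ⟨J, hJ⟩ := hb.finite.exists_minimal hne
    exact .of_blowUp X J hJ.prop
      (ih _ (h.orders_blowUp_lt hb hJ) (h.blowUp hJ.prop) (hb.blowUp hJ.prop) rfl)

/-! ### Maximal contact -/

/-- The hypersurface `i` has maximal contact with `X` along `K`: some exponent of order at most `m`
along `K` involves the variable `i` of `K`. -/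
def ExponentSystem.HasContact {I : Type u} (m : ℕ) (X : ExponentSystem I) (i : I) (K : Finset I) :
    Prop :=
  i ∈ K ∧ ∃ a ∈ X.exps K, ∑ k ∈ K, a k ≤ m ∧ 0 < a i

/-- Along each singular stratum, some hypersurface of `B` has maximal contact with `X`. -/
def ExponentSystem.IsCovered {I : Type u} (m : ℕ) (X : ExponentSystem I) (B : Finset I) : Prop :=
  ∀ K ∈ X.Sing m, ∃ i ∈ B, X.HasContact m i K

section Contact

variable {I : Type u} [DecidableEq I] {m : ℕ} {X : ExponentSystem I} {i : I} {J B : Finset I}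

theorem ExponentSystem.HasContact.blowUp {K' : Finset (Option I)} (hJ : J ∈ X.Sing m)
    (hK' : K' ∈ (X.blowUp m J).Sing m) (h : X.HasContact m i (blowDown J K')) :
    (X.blowUp m J).HasContact m (some i) K' := by
  obtain ⟨hi, a, ha, ham, hai⟩ := h
  have hK := (SupportFabric.mem_blowUp.1 hK'.1).1
  have hle : ∑ k ∈ K', transformExp m J a k ≤ ∑ i ∈ K'.eraseNone, a i :=
    sum_transformExp_le (fun hn => le_sum_of_subset hJ (subset_blowDown hn) hK a ha) ham
  have hge : m ≤ ∑ k ∈ K', transformExp m J a k := hK'.2 _ ⟨a, ha, rfl⟩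
  have hsupp := sum_eq_and_eq_zero_of_le eraseNone_subset_blowDown (hge.trans hle) ham
  refine ⟨?_, _, ⟨a, ha, rfl⟩, hle.trans hsupp.1.le, hai⟩
  by_contra hiK'
  exact hai.ne' (hsupp.2 i hi fun hi' => hiK' (mem_eraseNone.1 hi'))

theorem ExponentSystem.IsCovered.blowUp (h : X.IsCovered m B) (hJ : J ∈ X.Sing m) :
    (X.blowUp m J).IsCovered m (B.map .some) := by
  intro K' hK'
  obtain ⟨i, hi, hc⟩ := h _ (blowDown_mem_sing hJ hK')
  exact ⟨some i, mem_map_of_mem _ hi, hc.blowUp hJ hK'⟩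

theorem ExponentSystem.IsCovered.blowUp_singleton (h : X.IsCovered m (insert i B))
    (hi : {i} ∈ X.Sing m) : (X.blowUp m {i}).IsCovered m (B.map .some) := by
  intro K' hK'
  obtain ⟨j, hj, hc⟩ := h _ (blowDown_mem_sing hi hK')
  have hc' := hc.blowUp hi hK'
  obtain rfl | hj := mem_insert.1 hj
  · exact absurd (singleton_subset_iff.2 (mem_eraseNone.2 hc'.1))
      (SupportFabric.mem_blowUp.1 hK'.1).2
  · exact ⟨some j, mem_map_of_mem _ hj, hc'⟩

end Contact

/-! ### Coefficient systems -/

/-- The exponent that `a` contributes to the coefficients with respect to the variable `i`, scaled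
from the order `m - a i` to the order `m!`. Only meaningful if `a i < m`, when the natural-number
division is exact. -/
def coeffExp {I : Type*} (m : ℕ) (i : I) (a : I → ℕ) : I → ℕ := fun j =>
  m.factorial / (m - a i) * a j

/-- The exponents of the coefficient ideal, with respect to the variable `i` and the order `m`, of
the monomial ideal generated by `A`. -/
def coeffExps {I : Type*} (m : ℕ) (i : I) (A : Set (I → ℕ)) : Set (I → ℕ) :=
  coeffExp m i '' {a ∈ A | a i < m}

section CoeffExp

variable {I : Type*} {m : ℕ} {i : I} {a : I → ℕ}

theorem factorial_div_mul_sub {n : ℕ} (h : n < m) :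
    m.factorial / (m - n) * (m - n) = m.factorial :=
  Nat.div_mul_cancel (Nat.dvd_factorial (Nat.sub_pos_of_lt h) (Nat.sub_le m n))

theorem sum_coeffExp (m : ℕ) (i : I) (a : I → ℕ) (L : Finset I) :
    ∑ j ∈ L, coeffExp m i a j = m.factorial / (m - a i) * ∑ j ∈ L, a j :=
  (mul_sum L a _).symm

variable [DecidableEq I]

theorem factorial_le_sum_coeffExp {L : Finset I} (hi : i ∉ L) (ha : a i < m) :
    m.factorial ≤ ∑ j ∈ L, coeffExp m i a j ↔ m ≤ ∑ j ∈ insert i L, a j := by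
  have hdiv := factorial_div_mul_sub ha
  have hpos : 0 < m.factorial / (m - a i) := Nat.pos_of_mul_pos_right (hdiv ▸ m.factorial_pos)
  calc m.factorial ≤ ∑ j ∈ L, coeffExp m i a j
      ↔ m.factorial / (m - a i) * (m - a i) ≤ m.factorial / (m - a i) * ∑ j ∈ L, a j := by
        rw [hdiv, sum_coeffExp]
    _ ↔ m - a i ≤ ∑ j ∈ L, a j := Nat.mul_le_mul_left_iff hpos
    _ ↔ m ≤ ∑ j ∈ insert i L, a j := by rw [sum_insert hi, Nat.sub_le_iff_le_add']

theorem transformExp_coeffExp {J : Finset I} (hi : i ∉ J) (ha : a i < m) :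
    transformExp m.factorial J (coeffExp m i a) =
      coeffExp m (some i) (transformExp m (insert i J) a) := by
  funext k
  cases k with
  | some j => rfl
  | none =>
    calc ∑ j ∈ J, coeffExp m i a j - m.factorial
        = m.factorial / (m - a i) * ∑ j ∈ J, a j - m.factorial / (m - a i) * (m - a i) := by
          rw [sum_coeffExp, factorial_div_mul_sub ha]
      _ = m.factorial / (m - a i) * (∑ j ∈ J, a j - (m - a i)) := (Nat.mul_sub _ _ _).symm
      _ = m.factorial / (m - a i) * (∑ j ∈ insert i J, a j - m) := by
          rw [sum_insert hi, Nat.sub_sub_right _ ha.le, add_comm (a i)]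

theorem image_transformExp_coeffExps {J : Finset I} (hi : i ∉ J) (A : Set (I → ℕ)) :
    transformExp m.factorial J '' coeffExps m i A =
      coeffExps m (some i) (transformExp m (insert i J) '' A) := by
  ext b
  constructor
  · rintro ⟨_, ⟨a, ⟨ha, hai⟩, rfl⟩, rfl⟩
    exact ⟨_, ⟨⟨a, ha, rfl⟩, hai⟩, (transformExp_coeffExp hi hai).symm⟩
  · rintro ⟨_, ⟨⟨a, ha, rfl⟩, hai⟩, rfl⟩
    exact ⟨_, ⟨a, ⟨ha, hai⟩, rfl⟩, transformExp_coeffExp hi hai⟩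

theorem IdealLE.coeffExps {L : Finset I} {A B : Set (I → ℕ)} (h : IdealLE (insert i L) A B) :
    IdealLE L (coeffExps m i A) (coeffExps m i B) := by
  rintro _ ⟨a, ⟨ha, hai⟩, rfl⟩
  obtain ⟨b, hb, hba⟩ := h a ha
  have hbi := hba i (mem_insert_self i L)
  have hdiv : m.factorial / (m - b i) ≤ m.factorial / (m - a i) :=
    Nat.div_le_div_left (Nat.sub_le_sub_left hbi m) (Nat.sub_pos_of_lt hai)
  exact ⟨_, ⟨b, ⟨hb, hbi.trans_lt hai⟩, rfl⟩, fun j hj =>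
    Nat.mul_le_mul hdiv (hba j (mem_insert_of_mem hj))⟩

end CoeffExp

section Coeff

variable {I : Type u} [DecidableEq I] {m n : ℕ} {X : ExponentSystem I} {i : I} {J L : Finset I}

theorem ExponentSystem.nonempty_coeffExps (hi : {i} ∉ X.Sing m)
    (hL : insert i L ∈ X.fabric.strata) : (coeffExps m i (X.exps (insert i L))).Nonempty := by
  have hsub : {i} ⊆ insert i L := singleton_subset_iff.2 (mem_insert_self i L)
  obtain ⟨a, ha, hai⟩ : ∃ a ∈ X.exps {i}, a i < m := by
    by_contra! h
    exact hi ⟨X.fabric.mem_of_subset hsub hL, by simpa using h⟩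
  obtain ⟨b, hb, hba⟩ := (X.idealEq hsub hL).1 a ha
  exact ⟨_, b, ⟨hb, (hba i (mem_singleton_self i)).trans_lt hai⟩, rfl⟩

/-- The coefficient system of `X` with respect to the denominator `m` on a hypersurface `i` which
is not singular. Its denominator is `m!`. -/
def ExponentSystem.coeff (m : ℕ) (X : ExponentSystem I) (i : I) (hi : {i} ∉ X.Sing m) :
    ExponentSystem I where
  fabric :=
    { strata := {L | i ∉ L ∧ insert i L ∈ X.fabric.strata}
      mem_of_subset := fun _ _ h h₂ =>
        ⟨notMem_mono h h₂.1, X.fabric.mem_of_subset (insert_subset_insert i h) h₂.2⟩ }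
  exps L := coeffExps m i (X.exps (insert i L))
  nonempty _ hL := nonempty_coeffExps hi hL.2
  idealEq _ _ h hL :=
    have := X.idealEq (insert_subset_insert i h) hL.2
    ⟨this.1.coeffExps, this.2.coeffExps⟩

theorem ExponentSystem.mem_sing_coeff_iff (hi : {i} ∉ X.Sing m) :
    L ∈ (X.coeff m i hi).Sing m.factorial ↔ i ∉ L ∧ insert i L ∈ X.Sing m := by
  constructor
  · rintro ⟨⟨hiL, hL⟩, h⟩
    refine ⟨hiL, hL, fun a ha => ?_⟩
    obtain hai | hai := lt_or_ge (a i) m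
    · exact (factorial_le_sum_coeffExp hiL hai).1 (h _ ⟨a, ⟨ha, hai⟩, rfl⟩)
    · exact hai.trans (single_le_sum_of_canonicallyOrdered (mem_insert_self i L))
  · rintro ⟨hiL, hL, h⟩
    refine ⟨⟨hiL, hL⟩, ?_⟩
    rintro _ ⟨a, ⟨ha, hai⟩, rfl⟩
    exact (factorial_le_sum_coeffExp hiL hai).2 (h a ha)

theorem ExponentSystem.SingBounded.coeff (h : X.SingBounded m (n + 1)) (hi : {i} ∉ X.Sing m) :
    (X.coeff m i hi).SingBounded m.factorial n where
  finite := (h.finite.image (·.erase i)).subset fun _ hL =>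
    have hL := (mem_sing_coeff_iff hi).1 hL
    ⟨_, hL.2, erase_insert hL.1⟩
  card_le L hL := by
    have hL := (mem_sing_coeff_iff hi).1 hL
    have := h.card_le _ hL.2
    rwa [card_insert_of_notMem hL.1, Nat.add_le_add_iff_right] at this

theorem ExponentSystem.singleton_some_notMem_sing_blowUp (hi : {i} ∉ X.Sing m) :
    {some i} ∉ (X.blowUp m J).Sing m := fun h =>
  hi (map_some_mem_sing_blowUp.1 ((map_singleton .some i).symm ▸ h)).1

theorem ExponentSystem.coeff_blowUp_equivalent (hi : {i} ∉ X.Sing m) (hiJ : i ∉ J) :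
    ((X.coeff m i hi).blowUp m.factorial J).Equivalent
      ((X.blowUp m (insert i J)).coeff m (some i) (singleton_some_notMem_sing_blowUp hi)) where
  strata_eq := by
    ext L'
    have hi_mem : i ∈ blowDown J L' ↔ some i ∈ L' := by
      rw [mem_blowDown, or_iff_left fun h => hiJ h.2]
    have hsub : insert i J ⊆ (insert (some i) L').eraseNone ↔ J ⊆ L'.eraseNone := by
      rw [show (insert (some i) L').eraseNone = insert i L'.eraseNone by ext; simp,
        insert_subset_insert_iff hiJ]
    simp only [blowUp, coeff, Set.mem_ofPred_eq, SupportFabric.mem_blowUp, hi_mem, hsub,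
      blowDown_insert_some, and_assoc]
  idealEq L' _ := by
    simp only [blowUp, coeff, blowDown_insert_some, image_transformExp_coeffExps hiJ]
    exact .refl _ _

theorem ExponentSystem.IsCovered.of_sing_coeff_eq_empty {B : Finset I}
    (h : X.IsCovered m (insert i B)) (hi : {i} ∉ X.Sing m)
    (h₀ : (X.coeff m i hi).Sing m.factorial = ∅) : X.IsCovered m B := by
  intro K hK
  obtain ⟨j, hj, hjK⟩ := h K hK
  obtain rfl | hj := mem_insert.1 hj
  · have : K.erase j ∈ (X.coeff m j hi).Sing m.factorial :=
      (mem_sing_coeff_iff hi).2 ⟨notMem_erase j K, (insert_erase hjK.1).symm ▸ hK⟩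
    simp [h₀] at this
  · exact ⟨j, hj, hjK⟩

end Coeff

/-- All exponent systems whose singular locus is finite and consists of strata with at most `n`
elements are resolvable: the statement proved by induction on `n`. -/
def ResolvableUpTo (n : ℕ) : Prop :=
  ∀ {I : Type u} [DecidableEq I] {X : ExponentSystem I} {m : ℕ}, 0 < m → X.SingBounded m n →
    Resolvable m X

theorem ExponentSystem.IsCovered.resolvable {n m : ℕ} (ih : ResolvableUpTo.{u} n) {I : Type u}
    [DecidableEq I] {X : ExponentSystem I} {B : Finset I} (hB : X.IsCovered m B)
    (hX : X.SingBounded m (n + 1)) : Resolvable m X := by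
  induction hc : B.card generalizing I with
  | zero =>
    rw [card_eq_zero.1 hc] at hB
    exact .of_sing_eq_empty X (Set.eq_empty_iff_forall_notMem.2 fun K hK => by simpa using hB K hK)
  | succ c ihc =>
    obtain ⟨i, B, -, rfl, hcB⟩ := card_eq_succ.1 hc
    by_cases hi : {i} ∈ X.Sing m
    · exact .of_blowUp X {i} hi
        (ihc (hB.blowUp_singleton hi) (hX.blowUp hi) ((card_map _).trans hcB))
    refine Resolvable.lift (m := m.factorial)
      (fun {I} _ X Y => Y.SingBounded m (n + 1) ∧ ∃ i, ∃ hi : {i} ∉ Y.Sing m,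
        ∃ B, Finset.card B = c ∧ Y.IsCovered m (insert i B) ∧ X.Equivalent (Y.coeff m i hi))
      ?_ ?_ (ih m.factorial_pos (hX.coeff hi)) ⟨hX, i, hi, B, hcB, hB, .refl _⟩
    · rintro I _ X Y J ⟨hY, i, hi, B, hc, hB, hXY⟩ hJ
      obtain ⟨hiJ, hJ'⟩ := (mem_sing_coeff_iff hi).1 (hXY.sing_eq ▸ hJ)
      have hB' := hB.blowUp hJ'
      rw [map_insert] at hB'
      exact ⟨_, hJ', hY.blowUp hJ', some i, _, B.map .some, (card_map _).trans hc, hB',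
        hXY.blowUp.trans (coeff_blowUp_equivalent hi hiJ)⟩
    · rintro I _ X Y ⟨hY, i, hi, B, hc, hB, hXY⟩ h₀
      exact ihc (hB.of_sing_coeff_eq_empty hi (hXY.sing_eq ▸ h₀)) hY hc

theorem ResolvableUpTo.resolvable_of_sum_le {n m : ℕ} (ih : ResolvableUpTo.{u} n) (hm : 0 < m)
    {I : Type u} [DecidableEq I] {X : ExponentSystem I} (hX : X.SingBounded m (n + 1))
    (h : ∀ K ∈ X.Sing m, ∃ a ∈ X.exps K, ∑ k ∈ K, a k ≤ m) : Resolvable m X := by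
  refine ExponentSystem.IsCovered.resolvable ih (B := hX.finite.toFinset.biUnion id)
    (fun K hK => ?_) hX
  obtain ⟨a, ha, ham⟩ := h K hK
  obtain ⟨i, hi, hai⟩ : ∃ i ∈ K, a i ≠ 0 :=
    exists_ne_zero_of_sum_ne_zero (hm.trans_le (hK.2 a ha)).ne'
  exact ⟨i, mem_biUnion.2 ⟨K, hX.finite.mem_toFinset.2 hK, hi⟩, hi, a, ha, ham,
    Nat.pos_of_ne_zero hai⟩

/-! ### Companion systems -/

/-- The product of an exponent system with the monomial `ω`. -/
def ExponentSystem.mulMonomial {I : Type u} (ω : I → ℕ) (N : ExponentSystem I) :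
    ExponentSystem I where
  fabric := N.fabric
  exps K := (ω + ·) '' N.exps K
  nonempty K hK := (N.nonempty K hK).image _
  idealEq _ _ h hK := (N.idealEq h hK).image fun _ _ hab j hj => Nat.add_le_add_left (hab j hj) _

/-- The companion system of the product of `N` with the monomial `ω`: the sum of the `m`-th power
of `N` and of the `r`-th power of that product. With respect to the denominator `m * r` it is
singular where `N` has order at least `r` and the product has order at least `m`. -/
def ExponentSystem.companion {I : Type u} (m r : ℕ) (ω : I → ℕ) (N : ExponentSystem I) :
    ExponentSystem I where
  fabric := N.fabric
  exps K := (m • ·) '' N.exps K ∪ (fun a => r • (ω + a)) '' N.exps K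
  nonempty K hK := ((N.nonempty K hK).image _).inl
  idealEq _ _ h hK :=
    ((N.idealEq h hK).image fun _ _ hab j hj => Nat.mul_le_mul_left _ (hab j hj)).union
      ((N.idealEq h hK).image fun _ _ hab j hj =>
        Nat.mul_le_mul_left _ (Nat.add_le_add_left (hab j hj) _))

/-- The transform of the monomial `ω` under a blow-up centered in `J` if its product with `N` is
transformed with denominator `m` and `N` itself is transformed with denominator `r`. -/
def transformMonomial {I : Type u} (m r : ℕ) (J : Finset I) (ω : I → ℕ) : Option I → ℕ
  | none => ∑ j ∈ J, ω j + r - m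
  | some i => ω i

/-- `Y` is the product of the monomial `ω` and the system `N`, and along the `m`-singular strata of
`Y` the order of `N` is at most `r`. -/
structure IsFactorization {I : Type u} (m r : ℕ) (Y : ExponentSystem I) (ω : I → ℕ)
    (N : ExponentSystem I) : Prop where
  equivalent : Y.Equivalent (N.mulMonomial ω)
  exists_sum_le : ∀ K ∈ Y.Sing m, ∃ a ∈ N.exps K, ∑ k ∈ K, a k ≤ r

section Companion

variable {I : Type u} {m r n : ℕ} {ω : I → ℕ} {N Y : ExponentSystem I} {J K : Finset I}

theorem sum_smul_apply (n : ℕ) (a : I → ℕ) (K : Finset I) :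
    ∑ k ∈ K, (n • a) k = n * ∑ k ∈ K, a k :=
  (mul_sum K a n).symm

theorem sum_add_apply (ω a : I → ℕ) (K : Finset I) :
    ∑ k ∈ K, (ω + a) k = ∑ k ∈ K, ω k + ∑ k ∈ K, a k :=
  sum_add_distrib

theorem transformExp_smul (n : ℕ) (a : I → ℕ) :
    transformExp (n * m) J (n • a) = n • transformExp m J a := by
  funext k
  cases k with
  | none => rw [transformExp_none, sum_smul_apply, ← Nat.mul_sub]; rfl
  | some i => rfl

theorem transformExp_add {a : I → ℕ} {J' : Finset (Option I)} (hω : m ≤ ∑ j ∈ J, ω j + r)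
    (ha : none ∈ J' → r ≤ ∑ j ∈ J, a j) :
    ∀ k ∈ J', transformExp m J (ω + a) k =
      (transformMonomial m r J ω + transformExp r J a) k := by
  rintro (_ | i) hk
  · have := ha hk
    rw [transformExp_none, sum_add_apply]
    simp only [Pi.add_apply, transformMonomial, transformExp_none]
    omega
  · rfl

theorem ExponentSystem.mem_sing_mulMonomial_iff :
    K ∈ (N.mulMonomial ω).Sing m ↔
      K ∈ N.fabric.strata ∧ ∀ a ∈ N.exps K, m ≤ ∑ k ∈ K, ω k + ∑ k ∈ K, a k := by
  simp only [Sing, mulMonomial, Set.mem_ofPred_eq, Set.forall_mem_image, sum_add_apply]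

theorem ExponentSystem.mem_sing_companion_iff (hm : 0 < m) (hr : 0 < r) :
    K ∈ (N.companion m r ω).Sing (m * r) ↔ K ∈ N.Sing r ∧ K ∈ (N.mulMonomial ω).Sing m := by
  have hN (a : I → ℕ) : m * r ≤ ∑ k ∈ K, (m • a) k ↔ r ≤ ∑ k ∈ K, a k := by
    rw [sum_smul_apply, Nat.mul_le_mul_left_iff hm]
  have hωN (a : I → ℕ) : m * r ≤ ∑ k ∈ K, (r • (ω + a)) k ↔ m ≤ ∑ k ∈ K, (ω + a) k := by
    rw [sum_smul_apply, mul_comm m r, Nat.mul_le_mul_left_iff hr]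
  simp only [Sing, companion, mulMonomial, Set.mem_ofPred_eq, Set.mem_union, or_imp, forall_and,
    Set.forall_mem_image, hN, hωN]
  tauto

theorem IsFactorization.le_sum_add (h : IsFactorization m r Y ω N) (hJ : J ∈ Y.Sing m) :
    m ≤ ∑ j ∈ J, ω j + r := by
  obtain ⟨a, ha, har⟩ := h.exists_sum_le J hJ
  rw [h.equivalent.sing_eq, ExponentSystem.mem_sing_mulMonomial_iff] at hJ
  exact (hJ.2 a ha).trans (Nat.add_le_add_left har _)

theorem IsFactorization.mem_sing_companion_iff (h : IsFactorization m r Y ω N) (hm : 0 < m)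
    (hr : 0 < r) : K ∈ (N.companion m r ω).Sing (m * r) ↔ K ∈ N.Sing r ∧ K ∈ Y.Sing m := by
  rw [ExponentSystem.mem_sing_companion_iff hm hr, h.equivalent.sing_eq]

theorem IsFactorization.isMonomial (h : IsFactorization m 0 Y ω N) : Y.IsMonomial m ω where
  le K hK := (h.equivalent.idealEq K hK).1.trans fun _ hb => by
    obtain ⟨a, -, rfl⟩ := hb
    exact ⟨ω, rfl, fun k _ => Nat.le_add_right _ _⟩
  ge K hK := by
    obtain ⟨a, ha, ha₀⟩ := h.exists_sum_le K hK
    refine IdealLE.trans (B := (ω + ·) '' N.exps K) ?_ (h.equivalent.idealEq K hK.1).2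
    intro b hb
    rw [Set.mem_singleton_iff.1 hb]
    exact ⟨_, ⟨a, ha, rfl⟩, fun k hk =>
      (congrArg (ω k + ·) (sum_eq_zero_iff.1 (Nat.le_zero.1 ha₀) k hk)).le⟩

theorem IsFactorization.of_sing_companion_eq_empty (h : IsFactorization m (r + 1) Y ω N)
    (hm : 0 < m) (h₀ : (N.companion m (r + 1) ω).Sing (m * (r + 1)) = ∅) :
    IsFactorization m r Y ω N where
  equivalent := h.equivalent
  exists_sum_le K hK := by
    by_contra! hlt
    have : K ∈ (N.companion m (r + 1) ω).Sing (m * (r + 1)) :=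
      (h.mem_sing_companion_iff hm r.succ_pos).2 ⟨⟨(h.equivalent.strata_eq ▸ hK.1 :), hlt⟩, hK⟩
    simp [h₀] at this

variable [DecidableEq I]

theorem ExponentSystem.mulMonomial_blowUp_equivalent (hJ : J ∈ N.Sing r)
    (hω : m ≤ ∑ j ∈ J, ω j + r) :
    ((N.mulMonomial ω).blowUp m J).Equivalent
      ((N.blowUp r J).mulMonomial (transformMonomial m r J ω)) where
  strata_eq := rfl
  idealEq J' hJ' := by
    simp only [blowUp, mulMonomial, Set.image_image]
    exact idealEq_image fun a ha => transformExp_add hω fun hn =>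
      le_sum_of_subset hJ (subset_blowDown hn) (SupportFabric.mem_blowUp.1 hJ').1 a ha

theorem ExponentSystem.companion_blowUp_equivalent (hJ : J ∈ N.Sing r)
    (hω : m ≤ ∑ j ∈ J, ω j + r) :
    ((N.companion m r ω).blowUp (m * r) J).Equivalent
      ((N.blowUp r J).companion m r (transformMonomial m r J ω)) where
  strata_eq := rfl
  idealEq J' hJ' := by
    simp only [blowUp, companion, Set.image_union, Set.image_image]
    refine IdealEq.union (idealEq_image fun a _ j _ => congrFun (transformExp_smul m a) j)
      (idealEq_image fun a ha j hj => ?_)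
    rw [mul_comm m r, transformExp_smul]
    exact congrArg (r * ·) (transformExp_add hω (fun hn =>
      le_sum_of_subset hJ (subset_blowDown hn) (SupportFabric.mem_blowUp.1 hJ').1 a ha) j hj)

theorem IsFactorization.blowUp (h : IsFactorization m r Y ω N) (hJN : J ∈ N.Sing r)
    (hJ : J ∈ Y.Sing m) :
    IsFactorization m r (Y.blowUp m J) (transformMonomial m r J ω) (N.blowUp r J) where
  equivalent := h.equivalent.blowUp.trans
    (ExponentSystem.mulMonomial_blowUp_equivalent hJN (h.le_sum_add hJ))
  exists_sum_le K' hK' := by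
    have hK := ExponentSystem.blowDown_mem_sing hJ hK'
    obtain ⟨a, ha, har⟩ := h.exists_sum_le _ hK
    have hKN : blowDown J K' ∈ N.fabric.strata := (h.equivalent.strata_eq ▸ hK.1 :)
    exact ⟨_, ⟨a, ha, rfl⟩,
      (sum_transformExp_le (fun hn => ExponentSystem.le_sum_of_subset hJN (subset_blowDown hn)
        hKN a ha) har).trans ((sum_le_sum_of_subset eraseNone_subset_blowDown).trans har)⟩

theorem IsFactorization.resolvable_companion (h : IsFactorization m r Y ω N)
    (ih : ResolvableUpTo.{u} n) (hm : 0 < m) (hr : 0 < r) (hY : Y.SingBounded m (n + 1)) :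
    Resolvable (m * r) (N.companion m r ω) := by
  refine ih.resolvable_of_sum_le (Nat.mul_pos hm hr)
    (hY.of_sing_subset fun K hK => ((h.mem_sing_companion_iff hm hr).1 hK).2) fun K hK => ?_
  obtain ⟨a, ha, har⟩ := h.exists_sum_le K ((h.mem_sing_companion_iff hm hr).1 hK).2
  exact ⟨m • a, Or.inl ⟨a, ha, rfl⟩,
    (sum_smul_apply m a K).trans_le (Nat.mul_le_mul_left m har)⟩

end Companion

theorem IsFactorization.resolvable {n m r : ℕ} {I : Type u} [DecidableEq I] {ω : I → ℕ}
    {N Y : ExponentSystem I} (h : IsFactorization m r Y ω N) (ih : ResolvableUpTo.{u} n)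
    (hm : 0 < m) (hY : Y.SingBounded m (n + 1)) : Resolvable m Y := by
  induction r generalizing I with
  | zero => exact h.isMonomial.resolvable hY
  | succ r ihr =>
    refine Resolvable.lift (m := m * (r + 1))
      (fun {I} _ X Y => Y.SingBounded m (n + 1) ∧ ∃ ω N, IsFactorization m (r + 1) Y ω N ∧
        X.Equivalent (N.companion m (r + 1) ω))
      ?_ ?_ (h.resolvable_companion ih hm r.succ_pos hY) ⟨hY, ω, N, h, .refl _⟩
    · rintro I _ X Y J ⟨hY, ω, N, h, hX⟩ hJ
      obtain ⟨hJN, hJY⟩ := (h.mem_sing_companion_iff hm r.succ_pos).1 (hX.sing_eq ▸ hJ)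
      exact ⟨J, hJY, hY.blowUp hJY, _, _, h.blowUp hJN hJY, hX.blowUp.trans
        (ExponentSystem.companion_blowUp_equivalent hJN (h.le_sum_add hJY))⟩
    · rintro I _ X Y ⟨hY, ω, N, h, hX⟩ h₀
      exact ihr (h.of_sing_companion_eq_empty hm (hX.sing_eq ▸ h₀)) hY

theorem isFactorization_zero {I : Type u} {m r : ℕ} {X : ExponentSystem I}
    (h : ∀ K ∈ X.Sing m, ∃ a ∈ X.exps K, ∑ k ∈ K, a k ≤ r) : IsFactorization m r X 0 X where
  equivalent := ⟨rfl, fun K _ => by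
    simpa only [ExponentSystem.mulMonomial, zero_add, Set.image_id'] using .refl K (X.exps K)⟩
  exists_sum_le := h

theorem ExponentSystem.exists_sum_le_of_finite_sing {I : Type u} {m : ℕ} {X : ExponentSystem I}
    (h : (X.Sing m).Finite) : ∃ r, ∀ K ∈ X.Sing m, ∃ a ∈ X.exps K, ∑ k ∈ K, a k ≤ r := by
  choose! a ha using X.nonempty
  obtain ⟨r, hr⟩ := (h.image fun K => ∑ k ∈ K, a K k).bddAbove
  exact ⟨r, fun K hK => ⟨a K, ha K hK.1, hr ⟨K, hK, rfl⟩⟩⟩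

theorem ExponentSystem.empty_notMem_sing {I : Type u} {m : ℕ} {X : ExponentSystem I}
    (hm : 0 < m) : ∅ ∉ X.Sing m := fun h =>
  have ⟨a, ha⟩ := X.nonempty ∅ h.1
  hm.not_ge (h.2 a ha)

theorem resolvableUpTo (n : ℕ) : ResolvableUpTo.{u} n := by
  induction n with
  | zero =>
    intro I _ X m hm hX
    refine .of_sing_eq_empty X (Set.eq_empty_iff_forall_notMem.2 fun K hK => ?_)
    rw [card_eq_zero.1 (Nat.le_zero.1 (hX.card_le K hK))] at hK
    exact ExponentSystem.empty_notMem_sing hm hK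
  | succ n ih =>
    intro I _ X m hm hX
    obtain ⟨r, hr⟩ := ExponentSystem.exists_sum_le_of_finite_sing hX.finite
    exact (isFactorization_zero hr).resolvable ih hm hX

theorem ExponentSystem.resolvable {I : Type u} [DecidableEq I] {X : ExponentSystem I} {m : ℕ}
    (hm : 0 < m) (h : (X.Sing m).Finite) : Resolvable m X := by
  obtain ⟨n, hn⟩ := (h.image card).bddAbove
  exact resolvableUpTo n hm ⟨h, fun K hK => hn ⟨K, hK, rfl⟩⟩

/-! ### Exponent systems as models of polyhedra systems -/

/-- The point of `ℝ^K` given by the exponent `a` with respect to the denominator `d`. -/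
noncomputable def expPoint {I : Type u} (d : ℕ) (K : Finset I) (a : I → ℕ) : K → ℝ := fun k =>
  (a k : ℝ) / d

/-- The polyhedra of `D` are generated by the exponents of `X`. -/
structure IsModel {I : Type u} (X : ExponentSystem I) (D : PolyhedraSystem I) : Prop where
  fabric_eq : X.fabric = D.fabric
  Δ_eq : ∀ K ∈ D.fabric.strata, D.Δ K = posHull (expPoint D.d K '' X.exps K)

section PosHull

variable {ι : Type*} {A : Set (ι → ℝ)}

theorem posHull_empty : posHull (∅ : Set (ι → ℝ)) = ∅ := by
  rw [posHull, Set.empty_add, convexHull_empty]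

theorem mem_posHull_of_le {σ τ : ι → ℝ} (hσ : σ ∈ posHull A) (h : σ ≤ τ) : τ ∈ posHull A := by
  rw [← posHull_posHull]
  exact subset_convexHull ℝ _ ⟨σ, hσ, τ - σ, fun j => sub_nonneg.2 (h j), add_sub_cancel σ τ⟩

theorem le_sum_of_mem_posHull [Fintype ι] {c : ℝ} (hA : ∀ σ ∈ A, c ≤ ∑ j, σ j) :
    ∀ σ ∈ posHull A, c ≤ ∑ j, σ j := by
  have hconvex : Convex ℝ {τ : ι → ℝ | c ≤ ∑ j, τ j} :=
    convex_halfSpace_ge (f := fun τ : ι → ℝ => ∑ j, τ j)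
      ⟨fun _ _ => sum_add_distrib, fun _ _ => (mul_sum ..).symm⟩ c
  refine fun σ hσ => convexHull_min ?_ hconvex hσ
  rintro _ ⟨a, ha, t, ht, rfl⟩
  exact (hA a ha).trans (sum_le_sum fun j _ => le_add_of_nonneg_right (ht j))

end PosHull

section ExpPoint

variable {I : Type u} {d : ℕ} {J K : Finset I}

theorem sum_expPoint (d : ℕ) (K : Finset I) (a : I → ℕ) :
    ∑ k, expPoint d K a k = ((∑ k ∈ K, a k : ℕ) : ℝ) / d := by
  rw [← sum_coe_sort K a, Nat.cast_sum, sum_div]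
  rfl

theorem one_le_sum_expPoint (hd : 0 < d) (a : I → ℕ) :
    1 ≤ ∑ k, expPoint d K a k ↔ d ≤ ∑ k ∈ K, a k := by
  rw [sum_expPoint, one_le_div (Nat.cast_pos.2 hd), Nat.cast_le]

theorem exists_expPoint_eq {σ : K → ℝ} (hσ : ∀ j, ∃ n : ℕ, σ j = (n : ℝ) / d) :
    ∃ a, expPoint d K a = σ := by
  classical
  choose n hn using hσ
  exact ⟨fun i => if h : i ∈ K then n ⟨i, h⟩ else 0, funext fun k => by simp [expPoint, hn]⟩

theorem exists_le_expPoint (hd : 0 < d) {σ : K → ℝ} {b : I → ℕ}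
    (hb : ∀ k : K, k.1 ∈ J → σ k = (b k : ℝ) / d) :
    ∃ a : I → ℕ, (∀ j ∈ J, a j = b j) ∧ σ ≤ expPoint d K a := by
  classical
  refine ⟨fun i => if i ∈ J then b i else if hi : i ∈ K then ⌈σ ⟨i, hi⟩ * d⌉₊ else 0,
    fun j hj => if_pos hj, fun k => ?_⟩
  by_cases hk : k.1 ∈ J
  · simp [expPoint, hk, hb k hk]
  · simpa [expPoint, hk, le_div_iff₀ (Nat.cast_pos.2 hd : (0 : ℝ) < d)] using Nat.le_ceil (σ k * d)

theorem IsCharPolyhedron.posHull_expPoint {Δ : Set (K → ℝ)} (h : IsCharPolyhedron d Δ) :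
    posHull (expPoint d K '' {a | expPoint d K a ∈ Δ}) = Δ := by
  obtain ⟨A, hA, rfl⟩ := h
  refine Set.Subset.antisymm ?_ (posHull_mono fun σ hσ => ?_)
  · exact (posHull_mono (Set.image_subset_iff.2 fun _ ha => ha)).trans (posHull_posHull A).subset
  · obtain ⟨a, rfl⟩ := exists_expPoint_eq (hA σ hσ)
    exact ⟨a, subset_posHull A hσ, rfl⟩

theorem IsCharPolyhedron.nonempty_expPoint {Δ : Set (K → ℝ)} (h : IsCharPolyhedron d Δ)
    (hne : Δ.Nonempty) : {a | expPoint d K a ∈ Δ}.Nonempty := by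
  by_contra! hempty
  rw [← h.posHull_expPoint, hempty, Set.image_empty, posHull_empty] at hne
  exact Set.not_nonempty_empty hne

theorem lam_expPoint_sub [DecidableEq I] (hd : 0 < d) {J' : Finset (Option I)} {a : I → ℕ}
    (ha : d ≤ ∑ j ∈ J, a j) :
    lam J J' (expPoint d _ a) - eInfty J' = expPoint d J' (transformExp d J a) := by
  funext ⟨j, hj⟩
  cases j with
  | none =>
    calc ∑ j, expPoint d J a j - 1 = ((∑ j ∈ J, a j : ℕ) : ℝ) / d - 1 := by rw [sum_expPoint]
      _ = ((∑ j ∈ J, a j - d : ℕ) : ℝ) / d := by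
        rw [Nat.cast_sub ha, sub_div, div_self (Nat.cast_ne_zero.2 hd.ne')]
  | some i => exact sub_zero _

theorem eInfty_eq_zero {J' : Finset (Option I)} (h : none ∉ J') : eInfty J' = 0 := by
  funext ⟨j, hj⟩
  cases j with
  | none => exact absurd hj h
  | some i => rfl

end ExpPoint

section Model

variable {I : Type u} {X : ExponentSystem I} {D : PolyhedraSystem I} {J : Finset I}
  {J' : Finset (Option I)}

theorem IsModel.sing_eq (h : IsModel X D) : X.Sing D.d = D.Sing := by
  ext K
  constructor
  · intro hK
    have hK' : K ∈ D.fabric.strata := h.fabric_eq ▸ hK.1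
    have hne : K ≠ ∅ := fun h₀ => ExponentSystem.empty_notMem_sing D.d_pos (h₀ ▸ hK)
    obtain ⟨σ, hσ, hδ⟩ := ((D.isCharPolyhedron K hK').isLeast_contactExponent D.d_pos
      (D.nonempty K hK') hne).1
    refine ⟨hK', hδ ▸ le_sum_of_mem_posHull (Set.forall_mem_image.2 fun a ha => ?_) σ
      (h.Δ_eq K hK' ▸ hσ)⟩
    exact (one_le_sum_expPoint D.d_pos a).2 (hK.2 a ha)
  · intro hK
    refine ⟨h.fabric_eq ▸ hK.1, fun a ha => (one_le_sum_expPoint D.d_pos a).1 ?_⟩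
    exact D.one_le_of_mem_Sing hK _ (h.Δ_eq K hK.1 ▸ subset_posHull _ ⟨a, ha, rfl⟩)

theorem PolyhedraSystem.idealEq_expPoint_mem (D : PolyhedraSystem I) {K : Finset I} (hJK : J ⊆ K)
    (hK : K ∈ D.fabric.strata) :
    IdealEq J {a | expPoint D.d J a ∈ D.Δ J} {a | expPoint D.d K a ∈ D.Δ K} := by
  rw [D.proj J K hJK hK]
  constructor
  · rintro b ⟨σ, hσ, hσb⟩
    obtain ⟨a, hab, hσa⟩ := exists_le_expPoint (J := J) (σ := σ) D.d_pos
      fun k hk => congrFun hσb ⟨k, hk⟩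
    refine ⟨a, ?_, fun j hj => (hab j hj).le⟩
    exact D.posHull_Δ hK ▸ mem_posHull_of_le (subset_posHull _ hσ) hσa
  · exact fun a ha => ⟨a, ⟨_, ha, rfl⟩, fun _ _ => le_rfl⟩

/-- The model of a polyhedra system given by all the points of its polyhedra with coordinates in
`(1/d) ℤ_{≥0}`. -/
def PolyhedraSystem.toExponentSystem (D : PolyhedraSystem I) : ExponentSystem I where
  fabric := D.fabric
  exps K := {a | expPoint D.d K a ∈ D.Δ K}
  nonempty K hK := (D.isCharPolyhedron K hK).nonempty_expPoint (D.nonempty K hK)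
  idealEq _ _ := D.idealEq_expPoint_mem

theorem PolyhedraSystem.isModel_toExponentSystem (D : PolyhedraSystem I) :
    IsModel D.toExponentSystem D where
  fabric_eq := rfl
  Δ_eq K hK := (D.isCharPolyhedron K hK).posHull_expPoint.symm

variable [DecidableEq I]

theorem IsModel.charΔ_of_none_mem (h : IsModel X D) (hJ : J ∈ D.Sing) (hn : none ∈ J')
    (hK : blowDown J J' ∈ D.fabric.strata) :
    D.charΔ J J' = posHull (expPoint D.d J' '' (transformExp D.d J '' X.exps (blowDown J J'))) := by
  have hle := ExponentSystem.le_sum_of_subset (h.sing_eq ▸ hJ) (subset_blowDown hn)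
    (h.fabric_eq ▸ hK : blowDown J J' ∈ X.fabric.strata)
  rw [blowDown_of_none_mem hn] at hle hK ⊢
  have hlam (A : Set (↥(J'.eraseNone ∪ J) → ℝ)) :
      posHull (lam J J' '' posHull A) = posHull (lam J J' '' A) :=
    posHull_image_posHull (lamLin J J') (lamLin_nonneg J J') A
  rw [PolyhedraSystem.charΔ, PolyhedraSystem.totalΔ, if_pos hn, h.Δ_eq _ hK, hlam,
    image_sub_posHull, Set.image_image, Set.image_image, Set.image_image]
  exact congrArg posHull (Set.image_congr fun a ha => lam_expPoint_sub D.d_pos (hle a ha))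

theorem IsModel.charΔ_of_none_notMem (h : IsModel X D) (hn : none ∉ J')
    (hK : blowDown J J' ∈ D.fabric.strata) :
    D.charΔ J J' = posHull (expPoint D.d J' '' (transformExp D.d J '' X.exps (blowDown J J'))) := by
  rw [blowDown_of_none_notMem hn] at hK ⊢
  rw [PolyhedraSystem.charΔ, PolyhedraSystem.totalΔ, if_neg hn, eInfty_eq_zero hn]
  simp only [sub_zero, Set.image_id']
  apply (dropNone_bijective hn).1.image_injective
  rw [Set.image_preimage_eq _ (dropNone_bijective hn).2, h.Δ_eq _ hK,
    image_posHull _ dropNone_image_nonneg, Set.image_image, Set.image_image]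
  rfl

theorem IsModel.charTransform (h : IsModel X D) (hJ : J ∈ D.Sing) :
    IsModel (X.blowUp D.d J) (D.charTransform J hJ) where
  fabric_eq := congrArg (·.blowUp J) h.fabric_eq
  Δ_eq J' hJ' := by
    have hK := (SupportFabric.mem_blowUp.1 hJ').1
    by_cases hn : none ∈ J'
    · exact h.charΔ_of_none_mem hJ hn hK
    · exact h.charΔ_of_none_notMem hn hK

end Model

theorem Resolvable.exists_finiteCharSeq {I₀ : Type u} [DecidableEq I₀] {D₀ : PolyhedraSystem I₀}
    {m : ℕ} {I : Type u} [DecidableEq I] {X : ExponentSystem I} (hX : Resolvable m X) :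
    ∀ {D : PolyhedraSystem I}, D.d = m → IsModel X D → FiniteCharSeq D₀ D →
      ∃ (I' : Type u) (_ : DecidableEq I') (D' : PolyhedraSystem I'),
        FiniteCharSeq D₀ D' ∧ D'.Sing = ∅ := by
  induction hX with
  | of_sing_eq_empty X h =>
    rintro D rfl hD hseq
    exact ⟨_, _, D, hseq, hD.sing_eq ▸ h⟩
  | of_blowUp X J hJ _ ih =>
    rintro D rfl hD hseq
    have hJD : J ∈ D.Sing := hD.sing_eq ▸ hJ
    exact ih (D := D.charTransform J hJD) rfl (hD.charTransform hJD) (.step hseq J hJD)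

end PolyhedraSystems

theorem mainTheorem1_general {I : Type u} [DecidableEq I] (D : PolyhedraSystems.PolyhedraSystem I)
    (hD : D.Sing.Finite) :
    ∃ (I' : Type u) (_ : DecidableEq I') (D' : PolyhedraSystems.PolyhedraSystem I'),
      PolyhedraSystems.FiniteCharSeq D D' ∧ D'.Sing = ∅ :=
  have hmodel := D.isModel_toExponentSystem
  (PolyhedraSystems.ExponentSystem.resolvable D.d_pos (hmodel.sing_eq ▸ hD)).exists_finiteCharSeq
    rfl hmodel .refl

theorem mainTheorem1 {I : Type u} [Finite I] [DecidableEq I]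
    (D : PolyhedraSystems.PolyhedraSystem I) :
    ∃ (I' : Type u) (_ : DecidableEq I') (D' : PolyhedraSystems.PolyhedraSystem I'),
      PolyhedraSystems.FiniteCharSeq D D' ∧ D'.Sing = ∅ :=
  mainTheorem1_general D (Set.toFinite _)
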